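/- **Hypergraphs.** A signature $\Sigma$ is a set of labels with functions $\mathrm{dom},\mathrm{cod}:\Sigma\to\mathbb N$. A *linear hypergraph* $H$ over $\Sigma$ consists of finite totally ordered sets $T$ (target vertices) and $S$ (source vertices), a finite set $E$ of edges, functions $l:T\to E+1$ and $r:S\to E+1$ (where $1=\{\bullet\}$ is the interface), a bijection $\kappa:T\to S$, and a labelling $\lambda:E\to\Sigma$ with $|r^{-1}(e)|=\mathrm{dom}\,\lambda(e)$ and $|l^{-1}(e)|=\mathrm{cod}\,\lambda(e)$ for all $e\in E$. Its *inputs* are $l^{-1}(\bullet)$ and its *outputs* are $r^{-1}(\bullet)$, both ordered; $H:m\to n$ means that there are $m$ inputs and $n$ outputs. Two hypergraphs are *isomorphic* if there are bijections between their sets $T$, $S$ and $E$ that commute with $\kappa$ and $\lambda$ and map the ordered list $r^{-1}(e)$ to $r^{-1}(e')$ and the ordered list $l^{-1}(e)$ to $l^{-1}(e')$, for every edge $e$ with image $e'$, and that map the ordered list of inputs to that of inputs and the ordered list of outputs to that of outputs (the orders on $T$ and $S$ need not be preserved otherwise). **Operations.** * *Composition.* For $F:m\to n$ and $G:n\to p$,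 the hypergraph $F\,;G:m\to p$ is the disjoint union of $F$ and $G$ (vertices of $F$ ordered before those of $G$) with the outputs of $F$ and the inputs of $G$ deleted; a vertex $v$ with $\kappa_F(v)$ the $i$th output of $F$ is now connected to $\kappa_G(\text{$i$th input of }G)$, and all other connections are kept. * *Tensor.* For $F:m\to n$ and $G:p\to q$, $F\otimes G:m+p\to n+q$ is the disjoint union (vertices of $F$ before those of $G$). * *Identity.* $n:n\to n$ has $n$ target and $n$ source vertices, no edges, and connects the $i$th input to the $i$th output; the *empty hypergraph* has no vertices and no edges. * *Composite swap.* $\sigma_{1,1}$ is the edgeless hypergraph $2\to2$ that exchanges two wires, and $\sigma_{m,n}:m+n\to n+m$ is given by $\sigma_{0,n}=n$, $\sigma_{m,0}=m$, and, for $m,n\ge1$, $$\sigma_{m+1,1}=m\otimes\sigma_{1,1}\,;\,\sigma_{m,1}\otimes1,\qquad \sigma_{1,n+1}=\sigma_{1,n}\otimes 1\,;\,n\otimes\sigma_{1,1},$$ $$\sigma_{m+1,n+1}=m\otimes\sigma_{1,n}\otimes1\,;\,\sigma_{m,n}\otimes\sigma_{1,1}\,;\,n\otimes\sigma_{m,1}\otimes1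 .$$ * *Trace.* For $F:1+m\to1+n$, $\mathrm{Tr}^1(F):m\to n$ is obtained by deleting the first input $a$ and the first output $b$ of $F$ and connecting the vertex $v\neq a$ with $\kappa_F(v)=b$ (if there is one) to $\kappa_F(a)$, everything else being kept. For $F:x+m\to x+n$, $\mathrm{Tr}^0(F)=F$ and $\mathrm{Tr}^{x+1}(F)=\mathrm{Tr}^1(\mathrm{Tr}^x(F))$. **Theorem.** For every signature $\Sigma$, these operations are well defined on isomorphism classes, and make the isomorphism classes of linear hypergraphs $m\to n$ over $\Sigma$ the morphisms $m\to n$ of a traced PROP, i.e. of a strict symmetric traced monoidal category whose objects are the natural numbers, with addition as tensor on objects and with the identity on the unit object $0$ given by the empty hypergraph. That is, for all hypergraphs of suitable types, up to isomorphism: * (category) $m\,;F\equiv F\equiv F\,;n$ and $(F\,;G)\,;H\equiv F\,;(G\,;H)$; * (bifunctoriality) $m\otimes n\equiv m+n$ and $F\otimes G\,;H\otimes K\equiv(F\,;H)\otimes(G\,;K)$; * (strict monoidality) $0\otimes F\equiv F\equiv F\otimes0$ and $(F\otimes G)\otimes H\equiv F\otimes(G\otimes H)$; * (symmetry) $F\otimes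 G\,;\sigma_{n,q}\equiv\sigma_{m,p}\,;G\otimes F$ for $F:m\to n$, $G:p\to q$; $\sigma_{m,n}\,;\sigma_{n,m}\equiv m+n$; and the hexagons $\sigma_{m,n}\otimes p\,;n\otimes\sigma_{m,p}\equiv\sigma_{m,n+p}$ and $m\otimes\sigma_{n,p}\,;\sigma_{m,p}\otimes n\equiv\sigma_{m+n,p}$; * (tightening) $\mathrm{Tr}^x(x\otimes G\,;F\,;x\otimes H)\equiv G\,;\mathrm{Tr}^x(F)\,;H$ for $F:x+m\to x+n$, $G:p\to m$, $H:n\to q$; * (superposing) $\mathrm{Tr}^x(F\otimes G)\equiv\mathrm{Tr}^x(F)\otimes G$ for $F:x+m\to x+n$, $G:p\to q$; * (yanking) $\mathrm{Tr}^x(\sigma_{x,x})\equiv x$; * (exchange) $\mathrm{Tr}^y(\mathrm{Tr}^x(F))\equiv\mathrm{Tr}^x(\mathrm{Tr}^y(\sigma_{y,x}\otimes m\,;F\,;\sigma_{x,y}\otimes n))$ for $F:x+y+m\to x+y+n$. Here $\otimes$ binds tighter than $;$. -/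

import Mathlib

universe u v

/-! ### Signatures and linear hypergraphs -/

/-- A hypergraph signature: a set of edge labels with arities and coarities. -/
structure HypSignature where
  /-- the edge labels -/
  Label : Type u
  /-- number of sources of an edge with a given label -/
  dom : Label → ℕ
  /-- number of targets of an edge with a given label -/
  cod : Label → ℕ

/-- A linear hypergraph: finite totally ordered sets of target and source vertices, a finite set of
edges, left and right functions into `edges + 1` (the point `none` is the interface), and a
connections bijection. The carriers are arbitrary finite types, so that a disjoint union is a sum
type; two of them in bijection automatically have the same cardinality. -/
structure LinearHypergraph where
  /-- target vertices -/
  Vt : Type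
  /-- source vertices -/
  Vs : Type
  /-- edges -/
  E : Type
  [fintypeVt : Fintype Vt]
  [fintypeVs : Fintype Vs]
  [finiteE : Finite E]
  [orderVt : LinearOrder Vt]
  [orderVs : LinearOrder Vs]
  /-- the edge (or the interface) on the left of a target vertex -/
  left : Vt → Option E
  /-- the edge (or the interface) on the right of a source vertex -/
  right : Vs → Option E
  /-- the connections bijection -/
  conn : Vt ≃ Vs

attribute [instance] LinearHypergraph.fintypeVt LinearHypergraph.fintypeVs
  LinearHypergraph.finiteE LinearHypergraph.orderVt LinearHypergraph.orderVs

open Classical in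
/-- The inverse image of a point, as a finite set. -/
noncomputable def fiberFinset {V : Type} {A : Type} [Fintype V] (f : V → A) (a : A) : Finset V :=
  Finset.univ.filter (fun v => f v = a)

namespace LinearHypergraph

variable (F : LinearHypergraph)

/-- The set of inputs: target vertices whose left is the interface. -/
noncomputable def inputSet : Finset F.Vt := fiberFinset F.left none

/-- The set of outputs: source vertices whose right is the interface. -/
noncomputable def outputSet : Finset F.Vs := fiberFinset F.right none

/-- The inputs in their order. -/
noncomputable def inputs : List F.Vt := F.inputSet.sort (· ≤ ·)

/-- The outputs in their order. -/
noncomputable def outputs : List F.Vs := F.outputSet.sort (· ≤ ·)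

/-- The ordered sources of an edge. -/
noncomputable def sources (e : F.E) : List F.Vs := (fiberFinset F.right (some e)).sort (· ≤ ·)

/-- The ordered targets of an edge. -/
noncomputable def targets (e : F.E) : List F.Vt := (fiberFinset F.left (some e)).sort (· ≤ ·)

end LinearHypergraph

/-- A linear hypergraph with edges labelled in the signature `S`. -/
structure LabelledHypergraph (S : HypSignature.{u}) extends LinearHypergraph where
  /-- the labelling function -/
  label : E → S.Label
  dom_label : ∀ e, S.dom (label e) = (toLinearHypergraph.sources e).length
  cod_label : ∀ e, S.cod (label e) = (toLinearHypergraph.targets e).length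

/-- A labelled linear hypergraph homomorphism. -/
structure HypHom {S : HypSignature.{u}} (F G : LabelledHypergraph S) where
  /-- action on target vertices -/
  vmapt : F.Vt → G.Vt
  /-- action on source vertices -/
  vmaps : F.Vs → G.Vs
  /-- action on edges -/
  emap : F.E → G.E
  sources_map : ∀ e, (F.sources e).map vmaps = G.sources (emap e)
  targets_map : ∀ e, (F.targets e).map vmapt = G.targets (emap e)
  conn_map : ∀ v, vmaps (F.conn v) = G.conn (vmapt v)
  label_map : ∀ e, G.label (emap e) = F.label e

/-- `F ≡ G`: some homomorphism has bijective components and preserves the ordered interfaces. -/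
def HypIso {S : HypSignature.{u}} (F G : LabelledHypergraph S) : Prop :=
  ∃ h : HypHom F G,
    Function.Bijective h.vmapt ∧ Function.Bijective h.vmaps ∧ Function.Bijective h.emap ∧
      F.inputs.map h.vmapt = G.inputs ∧ F.outputs.map h.vmaps = G.outputs

theorem HypIso.refl {S : HypSignature.{u}} (F : LabelledHypergraph S) : HypIso F F :=
  ⟨⟨id, id, id, by simp, by simp, by simp, by simp⟩, Function.bijective_id, Function.bijective_id,
    Function.bijective_id, by simp, by simp⟩

theorem HypIso.symm {S : HypSignature.{u}} {F G : LabelledHypergraph S} (h : HypIso F G) :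
    HypIso G F := by
  obtain ⟨⟨a, b, c, hs, ht, hc, hl⟩, ha, hb, he, hi, ho⟩ := h
  dsimp only at ha hb he hi ho
  obtain ⟨a, rfl⟩ : ∃ a' : F.Vt ≃ G.Vt, ⇑a' = a := ⟨Equiv.ofBijective a ha, rfl⟩
  obtain ⟨b, rfl⟩ : ∃ b' : F.Vs ≃ G.Vs, ⇑b' = b := ⟨Equiv.ofBijective b hb, rfl⟩
  obtain ⟨c, rfl⟩ : ∃ c' : F.E ≃ G.E, ⇑c' = c := ⟨Equiv.ofBijective c he, rfl⟩
  refine ⟨⟨a.symm, b.symm, c.symm, fun e => ?_, fun e => ?_, fun v => ?_, fun e => ?_⟩,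
    a.symm.bijective, b.symm.bijective, c.symm.bijective, ?_, ?_⟩
  · have := hs (c.symm e)
    rw [Equiv.apply_symm_apply] at this
    rw [← this]; simp
  · have := ht (c.symm e)
    rw [Equiv.apply_symm_apply] at this
    rw [← this]; simp
  · rw [Equiv.symm_apply_eq, hc]; simp
  · rw [← hl]; simp
  · rw [← hi]; simp
  · rw [← ho]; simp

theorem HypIso.trans {S : HypSignature.{u}} {F G H : LabelledHypergraph S} (h : HypIso F G)
    (k : HypIso G H) : HypIso F H := by
  obtain ⟨h, h1, h2, h3, h4, h5⟩ := h
  obtain ⟨k, k1, k2, k3, k4, k5⟩ := k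
  refine ⟨⟨k.vmapt ∘ h.vmapt, k.vmaps ∘ h.vmaps, k.emap ∘ h.emap, fun e => ?_, fun e => ?_,
    fun v => ?_, fun e => ?_⟩, k1.comp h1, k2.comp h2, k3.comp h3, ?_, ?_⟩
  · rw [← List.map_map, h.sources_map, k.sources_map]; rfl
  · rw [← List.map_map, h.targets_map, k.targets_map]; rfl
  · simp [h.conn_map, k.conn_map]
  · simp [h.label_map, k.label_map]
  · rw [← List.map_map, h4, k4]
  · rw [← List.map_map, h5, k5]

/-- Labelled linear hypergraphs of type `m → n`, that is, with `m` inputs and `n` outputs. -/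
structure TypedHypergraph (S : HypSignature.{u}) (m n : ℕ) extends LabelledHypergraph S where
  card_inputs : toLinearHypergraph.inputSet.card = m
  card_outputs : toLinearHypergraph.outputSet.card = n

/-! ### Counting inverse images -/

/-- The left (or right) function of a disjoint union. -/
def sumIncidence {A B E E' : Type} (f : A → Option E) (g : B → Option E') :
    Lex (A ⊕ B) → Option (E ⊕ E') :=
  fun v => Sum.elim (fun a => (f a).map Sum.inl) (fun b => (g b).map Sum.inr) (ofLex v)

theorem card_fiberFinset {V A : Type} [Fintype V] (f : V → A) (a : A) :
    (fiberFinset f a).card = Nat.card {v // f v = a} := by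
  classical
  rw [Nat.card_eq_fintype_card, Fintype.card_subtype, fiberFinset]

theorem mem_fiberFinset {V A : Type} [Fintype V] {f : V → A} {a : A} {v : V} :
    v ∈ fiberFinset f a ↔ f v = a := by
  simp [fiberFinset]

theorem card_fiber_sumIncidence {A B E E' : Type} [Fintype A] [Fintype B] (f : A → Option E)
    (g : B → Option E') (x : Option (E ⊕ E')) :
    (fiberFinset (sumIncidence f g) x).card =
      (fiberFinset (fun a => (f a).map (Sum.inl : E → E ⊕ E')) x).card +
      (fiberFinset (fun b => (g b).map (Sum.inr : E' → E ⊕ E')) x).card := by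
  rw [card_fiberFinset, card_fiberFinset, card_fiberFinset, ← Nat.card_sum]
  exact Nat.card_congr (Equiv.subtypeSum (α := A) (β := B)
    (p := fun v => sumIncidence f g (toLex v) = x))

theorem card_fiber_sum_none {A B E E' : Type} [Fintype A] [Fintype B] (f : A → Option E)
    (g : B → Option E') :
    (fiberFinset (sumIncidence f g) none).card =
      (fiberFinset f none).card + (fiberFinset g none).card := by
  rw [card_fiber_sumIncidence]
  congr 2 <;> ext <;> simp [mem_fiberFinset]

theorem card_fiber_sum_inl {A B E E' : Type} [Fintype A] [Fintype B] (f : A → Option E)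
    (g : B → Option E') (e : E) :
    (fiberFinset (sumIncidence f g) (some (Sum.inl e))).card = (fiberFinset f (some e)).card := by
  rw [card_fiber_sumIncidence, Nat.add_eq_left.2]
  · congr 1; ext; simp [mem_fiberFinset]
  · rw [Finset.card_eq_zero]; ext; simp [mem_fiberFinset]

theorem card_fiber_sum_inr {A B E E' : Type} [Fintype A] [Fintype B] (f : A → Option E)
    (g : B → Option E') (e : E') :
    (fiberFinset (sumIncidence f g) (some (Sum.inr e))).card = (fiberFinset g (some e)).card := by
  rw [card_fiber_sumIncidence, Nat.add_eq_right.2]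
  · congr 1; ext; simp [mem_fiberFinset]
  · rw [Finset.card_eq_zero]; ext; simp [mem_fiberFinset]

theorem card_fiber_subtype {V E : Type} [Fintype V] (f : V → Option E) (p : V → Prop)
    [Fintype {v // p v}] (x : Option E) (h : ∀ v, f v = x → p v) :
    (fiberFinset (fun v : {v // p v} => f v.1) x).card = (fiberFinset f x).card := by
  rw [card_fiberFinset, card_fiberFinset]
  exact Nat.card_congr
    ⟨fun v => ⟨v.1.1, v.2⟩, fun v => ⟨⟨v.1, h _ v.2⟩, v.2⟩, fun _ => rfl, fun _ => rfl⟩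

theorem card_fiber_interior_none {V E : Type} [Fintype V] (f : V → Option E)
    [Fintype {v // f v ≠ none}] :
    (fiberFinset (fun v : {v // f v ≠ none} => f v.1) none).card = 0 := by
  rw [Finset.card_eq_zero]
  ext v
  simpa [mem_fiberFinset] using v.2

theorem card_fiber_erase_none {V E : Type} [Fintype V] (f : V → Option E) (a : V)
    (ha : f a = none) [Fintype {v // v ≠ a}] :
    (fiberFinset (fun v : {v // v ≠ a} => f v.1) none).card + 1 = (fiberFinset f none).card := by
  classical
  have hm : a ∈ fiberFinset f none := mem_fiberFinset.2 ha
  rw [← Finset.card_erase_add_one hm, Nat.add_right_cancel_iff,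
    ← Finset.card_map (Function.Embedding.subtype _)]
  congr 1
  ext v
  simp [mem_fiberFinset, and_comm]

/-! ### The operations -/

namespace TypedHypergraph

variable {S : HypSignature.{u}} {m n p q : ℕ}

/-- Transport along equalities of the types; the underlying hypergraph is unchanged. -/
def cast {m' n' : ℕ} (hm : m = m') (hn : n = n') (F : TypedHypergraph S m n) :
    TypedHypergraph S m' n' where
  toLabelledHypergraph := F.toLabelledHypergraph
  card_inputs := F.card_inputs.trans hm
  card_outputs := F.card_outputs.trans hn

/-- The `i`th input. -/
noncomputable def input (F : TypedHypergraph S m n) (i : Fin m) : F.Vt :=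
  F.inputSet.orderIsoOfFin F.card_inputs i

/-- The `i`th output. -/
noncomputable def output (F : TypedHypergraph S m n) (i : Fin n) : F.Vs :=
  F.outputSet.orderIsoOfFin F.card_outputs i

theorem left_input (F : TypedHypergraph S m n) (i : Fin m) : F.left (F.input i) = none :=
  mem_fiberFinset.1 (F.inputSet.orderIsoOfFin F.card_inputs i).2

theorem right_output (F : TypedHypergraph S m n) (i : Fin n) : F.right (F.output i) = none :=
  mem_fiberFinset.1 (F.outputSet.orderIsoOfFin F.card_outputs i).2

/-- The position of an input among the inputs. -/
noncomputable def inputIndex (F : TypedHypergraph S m n) (v : F.Vt) (h : F.left v = none) : Fin m :=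
  (F.inputSet.orderIsoOfFin F.card_inputs).symm ⟨v, mem_fiberFinset.2 h⟩

/-- The position of an output among the outputs. -/
noncomputable def outputIndex (F : TypedHypergraph S m n) (v : F.Vs) (h : F.right v = none) :
    Fin n :=
  (F.outputSet.orderIsoOfFin F.card_outputs).symm ⟨v, mem_fiberFinset.2 h⟩

@[simp] theorem input_inputIndex (F : TypedHypergraph S m n) (v : F.Vt) (h : F.left v = none) :
    F.input (F.inputIndex v h) = v := by
  simp [input, inputIndex]

@[simp] theorem output_outputIndex (F : TypedHypergraph S m n) (v : F.Vs) (h : F.right v = none) :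
    F.output (F.outputIndex v h) = v := by
  simp [output, outputIndex]

@[simp] theorem inputIndex_input (F : TypedHypergraph S m n) (i : Fin m)
    (h : F.left (F.input i) = none) : F.inputIndex (F.input i) h = i :=
  (F.inputSet.orderIsoOfFin F.card_inputs).symm_apply_apply i

@[simp] theorem outputIndex_output (F : TypedHypergraph S m n) (i : Fin n)
    (h : F.right (F.output i) = none) : F.outputIndex (F.output i) h = i :=
  (F.outputSet.orderIsoOfFin F.card_outputs).symm_apply_apply i

open Classical in
/-- The connections of a composite: a vertex connected to the `i`th output of `F` is connected to
what the `i`th input of `G` was connected to; the other connections are kept. -/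
noncomputable def compConn (F : TypedHypergraph S m n) (G : TypedHypergraph S n p) :
    Lex (F.Vt ⊕ {v : G.Vt // G.left v ≠ none}) ≃ Lex ({v : F.Vs // F.right v ≠ none} ⊕ G.Vs) where
  toFun v := toLex <| Sum.elim
    (fun v => if h : F.right (F.conn v) = none
      then Sum.inr (G.conn (G.input (F.outputIndex (F.conn v) h)))
      else Sum.inl ⟨F.conn v, h⟩)
    (fun v => Sum.inr (G.conn v.1)) (ofLex v)
  invFun w := toLex <| Sum.elim
    (fun w => Sum.inl (F.conn.symm w.1))
    (fun w => if h : G.left (G.conn.symm w) = none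
      then Sum.inl (F.conn.symm (F.output (G.inputIndex (G.conn.symm w) h)))
      else Sum.inr ⟨G.conn.symm w, h⟩) (ofLex w)
  left_inv v := by
    induction v using Lex.rec with
    | h v =>
      rcases v with v | v
      · by_cases h : F.right (F.conn v) = none
        · simp [h, left_input]
        · simp [h]
      · simp [v.2]
  right_inv w := by
    induction w using Lex.rec with
    | h w =>
      rcases w with w | w
      · simp [w.2]
      · by_cases h : G.left (G.conn.symm w) = none
        · simp [h, right_output]
        · simp [h]

open Classical in
/-- Composition `F ; G`: the outputs of `F` and the inputs of `G` are deleted. -/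
noncomputable def comp (F : TypedHypergraph S m n) (G : TypedHypergraph S n p) :
    TypedHypergraph S m p where
  Vt := Lex (F.Vt ⊕ {v : G.Vt // G.left v ≠ none})
  Vs := Lex ({v : F.Vs // F.right v ≠ none} ⊕ G.Vs)
  E := F.E ⊕ G.E
  left := sumIncidence F.left (fun v => G.left v.1)
  right := sumIncidence (fun v => F.right v.1) G.right
  conn := compConn F G
  label := Sum.elim F.label G.label
  dom_label := by
    rintro (e | e)
    · simp only [LinearHypergraph.sources, Finset.length_sort, Sum.elim_inl, card_fiber_sum_inl]
      rw [F.dom_label, card_fiber_subtype _ _ _ (by simp +contextual)]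
      simp [LinearHypergraph.sources]
    · simp only [LinearHypergraph.sources, Finset.length_sort, Sum.elim_inr, card_fiber_sum_inr]
      rw [G.dom_label]
      simp [LinearHypergraph.sources]
  cod_label := by
    rintro (e | e)
    · simp only [LinearHypergraph.targets, Finset.length_sort, Sum.elim_inl, card_fiber_sum_inl]
      rw [F.cod_label]
      simp [LinearHypergraph.targets]
    · simp only [LinearHypergraph.targets, Finset.length_sort, Sum.elim_inr, card_fiber_sum_inr]
      rw [G.cod_label, card_fiber_subtype _ _ _ (by simp +contextual)]
      simp [LinearHypergraph.targets]
  card_inputs := by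
    simp only [LinearHypergraph.inputSet, card_fiber_sum_none]
    rw [card_fiber_interior_none]
    exact F.card_inputs
  card_outputs := by
    simp only [LinearHypergraph.outputSet, card_fiber_sum_none]
    rw [card_fiber_interior_none, Nat.zero_add]
    exact G.card_outputs

/-- Monoidal tensor `F ⊗ G`: disjoint union. -/
noncomputable def tensor (F : TypedHypergraph S m n) (G : TypedHypergraph S p q) :
    TypedHypergraph S (m + p) (n + q) where
  Vt := Lex (F.Vt ⊕ G.Vt)
  Vs := Lex (F.Vs ⊕ G.Vs)
  E := F.E ⊕ G.E
  left := sumIncidence F.left G.left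
  right := sumIncidence F.right G.right
  conn := (ofLex.trans (F.conn.sumCongr G.conn)).trans toLex
  label := Sum.elim F.label G.label
  dom_label := by
    rintro (e | e)
    · simp only [LinearHypergraph.sources, Finset.length_sort, Sum.elim_inl, card_fiber_sum_inl]
      rw [F.dom_label]
      simp [LinearHypergraph.sources]
    · simp only [LinearHypergraph.sources, Finset.length_sort, Sum.elim_inr, card_fiber_sum_inr]
      rw [G.dom_label]
      simp [LinearHypergraph.sources]
  cod_label := by
    rintro (e | e)
    · simp only [LinearHypergraph.targets, Finset.length_sort, Sum.elim_inl, card_fiber_sum_inl]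
      rw [F.cod_label]
      simp [LinearHypergraph.targets]
    · simp only [LinearHypergraph.targets, Finset.length_sort, Sum.elim_inr, card_fiber_sum_inr]
      rw [G.cod_label]
      simp [LinearHypergraph.targets]
  card_inputs := by
    simp only [LinearHypergraph.inputSet, card_fiber_sum_none]
    exact congrArg₂ (· + ·) F.card_inputs G.card_inputs
  card_outputs := by
    simp only [LinearHypergraph.outputSet, card_fiber_sum_none]
    exact congrArg₂ (· + ·) F.card_outputs G.card_outputs

variable (S) in
/-- A hypergraph without edges: every vertex is on the interface, and the `i`th input is connected
to the output given by a permutation. -/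
def edgeless (n : ℕ) (σ : Equiv.Perm (Fin n)) : TypedHypergraph S n n where
  Vt := Fin n
  Vs := Fin n
  E := Empty
  left _ := none
  right _ := none
  conn := σ
  label := Empty.elim
  dom_label e := e.elim
  cod_label e := e.elim
  card_inputs := by simp [LinearHypergraph.inputSet, fiberFinset]
  card_outputs := by simp [LinearHypergraph.outputSet, fiberFinset]

variable (S) in
/-- The identity hypergraph on `n`. -/
def identity (n : ℕ) : TypedHypergraph S n n := edgeless S n (Equiv.refl _)

variable (S) in
/-- The empty hypergraph: no vertices and no edges. -/
def empty : TypedHypergraph S 0 0 where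
  Vt := Empty
  Vs := Empty
  E := Empty
  orderVt := LinearOrder.lift' Empty.elim (fun a => a.elim) (β := ℕ)
  orderVs := LinearOrder.lift' Empty.elim (fun a => a.elim) (β := ℕ)
  left := Empty.elim
  right := Empty.elim
  conn := Equiv.refl _
  label := Empty.elim
  dom_label e := e.elim
  cod_label e := e.elim
  card_inputs := by simp [LinearHypergraph.inputSet, fiberFinset]
  card_outputs := by simp [LinearHypergraph.outputSet, fiberFinset]

variable (S) in
/-- The swap hypergraph for two wires. -/
def swapOneOne : TypedHypergraph S (1 + 1) (1 + 1) := edgeless S 2 (Equiv.swap 0 1)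

variable (S) in
/-- The composite swap of `m` wires with one wire. -/
noncomputable def swapManyOne : (m : ℕ) → TypedHypergraph S (m + 1) (1 + m)
  | 0 => (identity S 1).cast (by omega) (by omega)
  | 1 => swapOneOne S
  | m + 2 =>
      ((tensor (identity S (m + 1)) (swapOneOne S)).comp
        ((tensor (swapManyOne (m + 1)) (identity S 1)).cast (by omega) (Eq.refl _))).cast
          (by omega) (by omega)

variable (S) in
/-- The composite swap of one wire with `n` wires. -/
noncomputable def swapOneMany : (n : ℕ) → TypedHypergraph S (1 + n) (n + 1)
  | 0 => (identity S 1).cast (by omega) (by omega)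
  | 1 => swapOneOne S
  | n + 2 =>
      ((tensor (swapOneMany (n + 1)) (identity S 1)).comp
        ((tensor (identity S (n + 1)) (swapOneOne S)).cast (by omega) (Eq.refl _))).cast
          (by omega) (by omega)

variable (S) in
/-- The composite swap of `m` wires with `n` wires; for `m, n ≥ 1` it satisfies
`swap (m+1) (n+1) = m ⊗ swap 1 n ⊗ 1 ; swap m n ⊗ swap 1 1 ; n ⊗ swap m 1 ⊗ 1`. -/
noncomputable def compositeSwap : (m n : ℕ) → TypedHypergraph S (m + n) (n + m)
  | 0, n => (identity S n).cast (by omega) (by omega)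
  | m + 1, 0 => (identity S (m + 1)).cast (by omega) (by omega)
  | 1, n + 1 => swapOneMany S (n + 1)
  | m + 2, 1 => swapManyOne S (m + 2)
  | m + 2, n + 2 =>
      (((tensor (tensor (identity S (m + 1)) (swapOneMany S (n + 1))) (identity S 1)).comp
        ((tensor (compositeSwap (m + 1) (n + 1)) (swapOneOne S)).cast (by omega) (Eq.refl _))).comp
        ((tensor (tensor (identity S (n + 1)) (swapManyOne S (m + 1))) (identity S 1)).cast
          (by omega) (Eq.refl _))).cast (by omega) (by omega)

/-- The first input of a hypergraph `1 + m → 1 + n`. -/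
noncomputable def firstInput (F : TypedHypergraph S (1 + m) (1 + n)) : F.Vt :=
  F.input ⟨0, by omega⟩

/-- The first output of a hypergraph `1 + m → 1 + n`. -/
noncomputable def firstOutput (F : TypedHypergraph S (1 + m) (1 + n)) : F.Vs :=
  F.output ⟨0, by omega⟩

/-- The connections of a trace of one wire: the vertex connected to the first output is connected to
what the first input was connected to; the other connections are kept. -/
noncomputable def traceConn (F : TypedHypergraph S (1 + m) (1 + n)) :
    {v : F.Vt // v ≠ F.firstInput} ≃ {v : F.Vs // v ≠ F.firstOutput} where
  toFun v :=
    if h : F.conn v.1 = F.firstOutput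
    then ⟨F.conn F.firstInput, fun h' => v.2 (F.conn.injective (h.trans h'.symm))⟩
    else ⟨F.conn v.1, h⟩
  invFun w :=
    if h : F.conn.symm w.1 = F.firstInput
    then ⟨F.conn.symm F.firstOutput, fun h' => w.2 (F.conn.symm.injective (h.trans h'.symm))⟩
    else ⟨F.conn.symm w.1, h⟩
  left_inv v := by
    by_cases h : F.conn v.1 = F.firstOutput
    · have h' : v.1 = F.conn.symm F.firstOutput := by rw [← h]; simp
      apply Subtype.ext
      simp [h']
    · simp [h, v.2]
  right_inv w := by
    by_cases h : F.conn.symm w.1 = F.firstInput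
    · have h' : w.1 = F.conn F.firstInput := by rw [← h]; simp
      apply Subtype.ext
      simp [h']
    · simp [h, w.2]

open Classical in
/-- The trace of one wire: the first input and the first output are deleted. -/
noncomputable def traceOne (F : TypedHypergraph S (1 + m) (1 + n)) : TypedHypergraph S m n where
  Vt := {v : F.Vt // v ≠ F.firstInput}
  Vs := {v : F.Vs // v ≠ F.firstOutput}
  E := F.E
  left v := F.left v.1
  right v := F.right v.1
  conn := traceConn F
  label := F.label
  dom_label e := by
    simp only [LinearHypergraph.sources, Finset.length_sort]
    rw [F.dom_label, card_fiber_subtype]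
    · simp [LinearHypergraph.sources]
    · rintro v hv rfl
      simp [firstOutput, right_output] at hv
  cod_label e := by
    simp only [LinearHypergraph.targets, Finset.length_sort]
    rw [F.cod_label, card_fiber_subtype]
    · simp [LinearHypergraph.targets]
    · rintro v hv rfl
      simp [firstInput, left_input] at hv
  card_inputs := by
    have h1 := card_fiber_erase_none F.left F.firstInput (F.left_input _)
    have h2 := F.card_inputs
    simp only [LinearHypergraph.inputSet] at h2 ⊢
    omega
  card_outputs := by
    have h1 := card_fiber_erase_none F.right F.firstOutput (F.right_output _)
    have h2 := F.card_outputs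
    simp only [LinearHypergraph.outputSet] at h2 ⊢
    omega

/-- The trace of `x` wires, by tracing one wire at a time. -/
noncomputable def trace : (x : ℕ) → {m n : ℕ} → TypedHypergraph S (x + m) (x + n) →
    TypedHypergraph S m n
  | 0, _, _, F => F.cast (Nat.zero_add _) (Nat.zero_add _)
  | x + 1, _, _, F => traceOne (trace x (F.cast (Nat.add_assoc _ _ _) (Nat.add_assoc _ _ _)))

end TypedHypergraph

/-! ### Hypergraphs up to isomorphism -/

/-- Isomorphism as an equivalence relation on hypergraphs of type `m → n`. -/
def typedHypergraphSetoid (S : HypSignature.{u}) (m n : ℕ) : Setoid (TypedHypergraph S m n) where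
  r F G := HypIso F.toLabelledHypergraph G.toLabelledHypergraph
  iseqv := ⟨fun _ => HypIso.refl _, HypIso.symm, HypIso.trans⟩

/-- Isomorphism classes of hypergraphs of type `m → n`. -/
def HypClass (S : HypSignature.{u}) (m n : ℕ) : Type (max 1 u) :=
  Quotient (typedHypergraphSetoid S m n)

/-- The isomorphism class of a hypergraph. -/
def TypedHypergraph.toClass {S : HypSignature.{u}} {m n : ℕ} (F : TypedHypergraph S m n) :
    HypClass S m n :=
  Quotient.mk (typedHypergraphSetoid S m n) F

/-! ### Traced PROPs -/

/-- Transport of a morphism along equalities of objects. -/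
def homCast {Hom : ℕ → ℕ → Type v} {m n m' n' : ℕ} (hm : m = m') (hn : n = n') (f : Hom m n) :
    Hom m' n' :=
  hn ▸ hm ▸ f

/-- A traced PROP with hom-sets `Hom m n`: a strict symmetric traced monoidal category whose objects
are the natural numbers, with addition as tensor on objects and `0` as unit. Composition is written
in diagram order. -/
structure TracedPROP (Hom : ℕ → ℕ → Type v) where
  /-- identities -/
  id : (n : ℕ) → Hom n n
  /-- composition in diagram order -/
  comp : {m n p : ℕ} → Hom m n → Hom n p → Hom m p
  /-- tensor product of morphisms -/
  tensor : {m n p q : ℕ} → Hom m n → Hom p q → Hom (m + p) (n + q)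
  /-- symmetry -/
  swap : (m n : ℕ) → Hom (m + n) (n + m)
  /-- trace -/
  trace : (x : ℕ) → {m n : ℕ} → Hom (x + m) (x + n) → Hom m n
  id_comp : ∀ {m n : ℕ} (f : Hom m n), comp (id m) f = f
  comp_id : ∀ {m n : ℕ} (f : Hom m n), comp f (id n) = f
  comp_assoc : ∀ {m n p q : ℕ} (f : Hom m n) (g : Hom n p) (h : Hom p q),
    comp (comp f g) h = comp f (comp g h)
  tensor_id : ∀ m n : ℕ, tensor (id m) (id n) = id (m + n)
  tensor_comp : ∀ {m n p r s t : ℕ} (f : Hom m n) (g : Hom r s) (h : Hom n p) (k : Hom s t),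
    comp (tensor f g) (tensor h k) = tensor (comp f h) (comp g k)
  unit_tensor : ∀ {m n : ℕ} (f : Hom m n),
    homCast (Nat.zero_add m) (Nat.zero_add n) (tensor (id 0) f) = f
  tensor_unit : ∀ {m n : ℕ} (f : Hom m n),
    homCast (Nat.add_zero m) (Nat.add_zero n) (tensor f (id 0)) = f
  tensor_assoc : ∀ {m n p q r s : ℕ} (f : Hom m n) (g : Hom p q) (h : Hom r s),
    homCast (Nat.add_assoc m p r) (Nat.add_assoc n q s) (tensor (tensor f g) h) =
      tensor f (tensor g h)
  swap_natural : ∀ {m n p q : ℕ} (f : Hom m n) (g : Hom p q),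
    comp (tensor f g) (swap n q) = comp (swap m p) (tensor g f)
  swap_swap : ∀ m n : ℕ, comp (swap m n) (swap n m) = id (m + n)
  hexagon_left : ∀ m n p : ℕ,
    comp (tensor (swap m n) (id p))
        (homCast (Nat.add_assoc n m p).symm (Nat.add_assoc n p m).symm
          (tensor (id n) (swap m p))) =
      homCast (Nat.add_assoc m n p).symm (Eq.refl (n + p + m)) (swap m (n + p))
  hexagon_right : ∀ m n p : ℕ,
    comp (tensor (id m) (swap n p))
        (homCast (Nat.add_assoc m p n) (Nat.add_assoc p m n) (tensor (swap m p) (id n))) =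
      homCast (Nat.add_assoc m n p) (Eq.refl (p + (m + n))) (swap (m + n) p)
  tightening : ∀ (x : ℕ) {m n p q : ℕ} (g : Hom p m) (f : Hom (x + m) (x + n)) (h : Hom n q),
    trace x (comp (comp (tensor (id x) g) f) (tensor (id x) h)) = comp (comp g (trace x f)) h
  superposing : ∀ (x : ℕ) {m n p q : ℕ} (f : Hom (x + m) (x + n)) (g : Hom p q),
    trace x (homCast (Nat.add_assoc x m p) (Nat.add_assoc x n q) (tensor f g)) =
      tensor (trace x f) g
  yanking : ∀ x : ℕ, trace x (swap x x) = id x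
  exchange : ∀ (x y : ℕ) {m n : ℕ} (f : Hom (x + y + m) (x + y + n)),
    trace y (trace x (homCast (Nat.add_assoc x y m) (Nat.add_assoc x y n) f)) =
      trace x (trace y (homCast (Nat.add_assoc y x m) (Nat.add_assoc y x n)
        (comp (comp (tensor (swap y x) (id m)) f) (tensor (swap x y) (id n)))))

/-! Each law holds because its two sides are the same picture: the surviving vertices and the edges
correspond under re-bracketing of disjoint unions, and a connection is found on both sides by
following wires through the glued or fed-back interface points. The work lies in the orders, in the
strict equalities of types and in the recursively defined swaps.

Isomorphism is replaced by `WireIso`, which asks for bijections that are strictly increasing on the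
vertices of each edge (`FibreMap`) and send the `i`th input to the `π i`th and the `j`th output to
the `ρ j`th; for identity permutations this is `HypIso` (`hypIso_iff`). Since labels and types
dictate the sizes of all fibres, compatible vertex maps over a bijection of edges are automatically
bijective (`WireIso.ofMaps`). The category and monoidal laws are then explicit vertex maps with a
case analysis of the connections (`WireIso.compAssoc`, `WireIso.tensorComp`, `WireIso.tensorAssoc`).
Tightening and superposing are checked in this way for one traced wire and extended to `x` wires by
induction.

An edgeless hypergraph is determined by a function on the natural numbers (`IsWiring`). The
composite swap is the block transposition (`IsWiring.compositeSwap`), so its involutivity, the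
hexagons and yanking become arithmetic. In `WireIso` terms a swap is an identity with one permuted
interface; with commutativity of the disjoint union up to block transposition (`WireIso.tensorComm`)
this gives naturality.

For exchange, two feedback wires can be closed in either order (`eq_of_step_eq_step`,
`WireIso.traceOneTraceOne`). Hence a trace does not change when two adjacent traced wires are
transposed at the inputs and the outputs at once. Adjacent transpositions generate the symmetric
group, so every permutation of the traced wires is allowed (`hypIso_trace_of_perm`). The two sides
of the exchange law are traces of `x + y` wires that differ by a block transposition of these wires.
-/

/-! ### Maps of incidence functions -/

/-- A map of vertices over a map of edges which is strictly increasing on the vertices of each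
edge. -/
structure FibreMap {V W E E' : Type} [LinearOrder V] [LinearOrder W] (l : V → Option E)
    (l' : W → Option E')
    (e : E → E') (f : V → W) : Prop where
  map : ∀ v, l' (f v) = (l v).map e
  lt : ∀ v w, l v = l w → l v ≠ none → v < w → f v < f w

namespace FibreMap

variable {V W X A B E E' E'' : Type}

theorem id [LinearOrder V] (l : V → Option E) : FibreMap l l id id :=
  ⟨by simp, by simp⟩

theorem congr [LinearOrder V] [LinearOrder W] {l : V → Option E} {l' : W → Option E'}
    {e e' : E → E'} {f : V → W} (hf : FibreMap l l' e f) (h : ∀ x, e x = e' x) :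
    FibreMap l l' e' f :=
  (funext h : e = e') ▸ hf

theorem comp [LinearOrder V] [LinearOrder W] [LinearOrder X] {l : V → Option E}
    {l' : W → Option E'} {l'' : X → Option E''}
    {e : E → E'} {e' : E' → E''} {f : V → W} {g : W → X} (hg : FibreMap l' l'' e' g)
    (hf : FibreMap l l' e f) : FibreMap l l'' (e' ∘ e) (g ∘ f) := by
  refine ⟨fun v => ?_, fun v w h hn hlt => hg.lt _ _ ?_ ?_ (hf.lt _ _ h hn hlt)⟩
  · simp [hg.map, hf.map]
  · rw [hf.map, hf.map, h]
  · simpa [hf.map] using hn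

/-- The order condition skips the interface, so it is vacuous here. -/
theorem of_none [LinearOrder V] [LinearOrder W] {l : V → Option E} {l' : W → Option E'}
    {e : E → E'} {f : V → W}
    (h : ∀ v, l v = none) (h' : ∀ v, l' (f v) = none) : FibreMap l l' e f :=
  ⟨fun v => by simp [h, h'], fun v _ _ hn => absurd (h v) hn⟩

theorem of_isEmpty [LinearOrder V] [LinearOrder W] [IsEmpty V] {l : V → Option E}
    {l' : W → Option E'} {e : E → E'}
    {f : V → W} : FibreMap l l' e f :=
  ⟨fun v => isEmptyElim v, fun v => isEmptyElim v⟩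

theorem inl [LinearOrder A] [LinearOrder B] (l : A → Option E) (l' : B → Option E') :
    FibreMap l (sumIncidence l l') Sum.inl (fun a => toLex (Sum.inl a)) :=
  ⟨fun _ => rfl, fun _ _ _ _ h => Sum.Lex.inl_lt_inl_iff.2 h⟩

theorem inr [LinearOrder A] [LinearOrder B] (l : A → Option E) (l' : B → Option E') :
    FibreMap l' (sumIncidence l l') Sum.inr (fun b => toLex (Sum.inr b)) :=
  ⟨fun _ => rfl, fun _ _ _ _ h => Sum.Lex.inr_lt_inr_iff.2 h⟩

/-- Only vertices of one edge are compared, and an edge of a disjoint union has all its vertices in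
one summand. Hence nothing is required about the relative order of the values of `f` and `g`. -/
theorem sumElim [LinearOrder A] [LinearOrder B] [LinearOrder W] {l : A → Option E}
    {l' : B → Option E'} {k : W → Option E''} {e : E → E''} {e' : E' → E''} {f : A → W} {g : B → W}
    (hf : FibreMap l k e f) (hg : FibreMap l' k e' g) :
    FibreMap (sumIncidence l l') k (Sum.elim e e') (fun v => Sum.elim f g (ofLex v)) := by
  constructor
  · rintro (a | b)
    · refine (hf.map a).trans ?_
      show _ = ((l a).map Sum.inl).map _
      simp
    · refine (hg.map b).trans ?_
      show _ = ((l' b).map Sum.inr).map _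
      simp
  · rintro (a | a) (b | b) h hn hlt
    · change (l a).map Sum.inl = (l b).map Sum.inl at h
      change (l a).map Sum.inl ≠ none at hn
      exact hf.lt a b (Option.map_injective Sum.inl_injective h) (by simpa using hn)
        (Sum.Lex.inl_lt_inl_iff.1 hlt)
    · change (l a).map Sum.inl = (l' b).map Sum.inr at h
      change (l a).map Sum.inl ≠ none at hn
      cases h1 : l a <;> cases h2 : l' b <;> simp_all
    · change (l' a).map Sum.inr = (l b).map Sum.inl at h
      change (l' a).map Sum.inr ≠ none at hn
      cases h1 : l' a <;> cases h2 : l b <;> simp_all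
    · change (l' a).map Sum.inr = (l' b).map Sum.inr at h
      change (l' a).map Sum.inr ≠ none at hn
      exact hg.lt a b (Option.map_injective Sum.inr_injective h) (by simpa using hn)
        (Sum.Lex.inr_lt_inr_iff.1 hlt)

theorem sumMap {A' B' D D' : Type} [LinearOrder A] [LinearOrder B] [LinearOrder A']
    [LinearOrder B'] {l : A → Option E} {l' : B → Option E'} {k : A' → Option D}
    {k' : B' → Option D'} {e : E → D} {e' : E' → D'} {f : A → A'} {g : B → B'}
    (hf : FibreMap l k e f) (hg : FibreMap l' k' e' g) :
    FibreMap (sumIncidence l l') (sumIncidence k k') (Sum.map e e')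
      (fun v => toLex (Sum.map f g (ofLex v))) := by
  have h := ((FibreMap.inl k k').comp hf).sumElim ((FibreMap.inr k k').comp hg)
  constructor
  · rintro (v | v)
    exacts [h.map (toLex (Sum.inl v)), h.map (toLex (Sum.inr v))]
  · rintro (v | v) (w | w)
    exacts [h.lt (toLex (Sum.inl v)) (toLex (Sum.inl w)),
      h.lt (toLex (Sum.inl v)) (toLex (Sum.inr w)), h.lt (toLex (Sum.inr v)) (toLex (Sum.inl w)),
      h.lt (toLex (Sum.inr v)) (toLex (Sum.inr w))]

theorem val [LinearOrder V] (l : V → Option E) (p : V → Prop) :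
    FibreMap (fun v : {v // p v} => l v.1) l _root_.id Subtype.val :=
  ⟨by simp, fun _ _ _ _ h => h⟩

theorem codRestrict [LinearOrder V] [LinearOrder W] {l : V → Option E} {l' : W → Option E'}
    {e : E → E'}
    {f : V → W} (hf : FibreMap l l' e f) (p : W → Prop) (h : ∀ v, p (f v)) :
    FibreMap l (fun w : {w // p w} => l' w.1) e (fun v => ⟨f v, h v⟩) :=
  ⟨hf.map, hf.lt⟩

/-- The inverse of a strictly increasing bijection between linear orders is strictly increasing;
trichotomy gives this fibre by fibre. -/
theorem symm [LinearOrder V] [LinearOrder W] {l : V → Option E} {l' : W → Option E'} {e : E ≃ E'}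
    {f : V ≃ W} (hf : FibreMap l l' e f) : FibreMap l' l e.symm f.symm := by
  have hm : ∀ w, l (f.symm w) = (l' w).map e.symm := fun w => by
    have := hf.map (f.symm w)
    rw [Equiv.apply_symm_apply] at this
    simp [this]
  refine ⟨hm, fun v w h hn hlt => ?_⟩
  rcases lt_trichotomy (f.symm v) (f.symm w) with h1 | h1 | h1
  · exact h1
  · exact absurd (f.symm.injective h1) hlt.ne
  · have := hf.lt _ _ (by rw [hm, hm, h]) (by rw [hm, ← h]; simpa using hn) h1
    simp only [Equiv.apply_symm_apply] at this
    exact absurd this hlt.asymm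

theorem injective [LinearOrder V] [LinearOrder W] {l : V → Option E} {l' : W → Option E'}
    {e : E → E'}
    (he : Function.Injective e) {f : V → W} (hf : FibreMap l l' e f)
    (h0 : ∀ v w, l v = none → l w = none → f v = f w → v = w) : Function.Injective f := by
  intro v w h
  have h1 : l v = l w := Option.map_injective he (by rw [← hf.map, ← hf.map, h])
  by_cases hn : l v = none
  · exact h0 v w hn (h1 ▸ hn) h
  · rcases lt_trichotomy v w with h2 | h2 | h2
    · exact absurd h (hf.lt _ _ h1 hn h2).ne
    · exact h2
    · exact absurd h (hf.lt _ _ h1.symm (h1 ▸ hn) h2).ne'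

/-- Monotonicity makes `f` injective on each edge and `h0` does so on the interface. Each fibre is
then mapped injectively into a fibre of the same size, hence onto it. -/
theorem bijective [LinearOrder V] [LinearOrder W] [Fintype V] [Fintype W] {l : V → Option E}
    {l' : W → Option E'} {e : E ≃ E'} {f : V → W} (hf : FibreMap l l' e f)
    (h0 : ∀ v w, l v = none → l w = none → f v = f w → v = w)
    (hc : ∀ x, (fiberFinset l x).card = (fiberFinset l' (x.map e)).card) :
    Function.Bijective f := by
  classical
  have hi := hf.injective e.injective h0
  refine ⟨hi, fun w => ?_⟩
  have hx : ((l' w).map e.symm).map e = l' w := by simp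
  have hsub : (fiberFinset l ((l' w).map e.symm)).image f ⊆ fiberFinset l' (l' w) := by
    intro y hy
    obtain ⟨v, hv, rfl⟩ := Finset.mem_image.1 hy
    rw [mem_fiberFinset] at hv ⊢
    rw [hf.map, hv, hx]
  have heq := Finset.eq_of_subset_of_card_le hsub (by
    rw [Finset.card_image_of_injective _ hi, hc, hx])
  have hw : w ∈ fiberFinset l' (l' w) := mem_fiberFinset.2 rfl
  rw [← heq] at hw
  obtain ⟨v, -, hv⟩ := Finset.mem_image.1 hw
  exact ⟨v, hv⟩

/-- The vertices of an edge, listed in order, are mapped to those of its image. -/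
theorem sort_map [LinearOrder V] [LinearOrder W] [Fintype V] [Fintype W] {l : V → Option E}
    {l' : W → Option E'} {e : E ≃ E'} {f : V ≃ W} (hf : FibreMap l l' e f) (x : E) :
    ((fiberFinset l (some x)).sort (· ≤ ·)).map f =
      (fiberFinset l' (some (e x))).sort (· ≤ ·) := by
  -- Two sorted lists with the same elements are equal.
  refine List.Perm.eq_of_pairwise' (r := (· ≤ ·)) ?_ (Finset.pairwise_sort _ _) ?_
  · rw [List.pairwise_map]
    refine List.Pairwise.imp_of_mem ?_ (Finset.pairwise_sort (fiberFinset l (some x)) (· ≤ ·))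
    intro a b ha hb hab
    rw [Finset.mem_sort, mem_fiberFinset] at ha hb
    rcases hab.lt_or_eq with h | h
    · exact (hf.lt _ _ (ha.trans hb.symm) (by simp [ha]) h).le
    · rw [h]
  · rw [List.perm_ext_iff_of_nodup
      ((Finset.sort_nodup _ _).map f.injective) (Finset.sort_nodup _ _)]
    intro w
    simp only [List.mem_map, Finset.mem_sort, mem_fiberFinset]
    constructor
    · rintro ⟨v, hv, rfl⟩
      simp [hf.map, hv]
    · intro hw
      exact ⟨f.symm w, by simp [hf.symm.map, hw], by simp⟩

/-- Converse of `sort_map`: membership in the lists gives the incidence, comparison of positions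
gives the monotonicity. The interface list `h0` ensures that interface vertices stay on the
interface. -/
theorem of_sort_map [LinearOrder V] [LinearOrder W] [Fintype V] [Fintype W] {l : V → Option E}
    {l' : W → Option E'} {e : E → E'} {f : V → W}
    (h : ∀ x, ((fiberFinset l (some x)).sort (· ≤ ·)).map f =
      (fiberFinset l' (some (e x))).sort (· ≤ ·))
    (h0 : ((fiberFinset l none).sort (· ≤ ·)).map f = (fiberFinset l' none).sort (· ≤ ·)) :
    FibreMap l l' e f := by
  constructor
  · intro v
    cases hv : l v with
    | none =>
      have h1 : v ∈ (fiberFinset l none).sort (· ≤ ·) := by simp [mem_fiberFinset, hv]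
      have h2 := List.mem_map_of_mem (f := f) h1
      rw [h0] at h2
      simpa [mem_fiberFinset] using h2
    | some x =>
      have h1 : v ∈ (fiberFinset l (some x)).sort (· ≤ ·) := by simp [mem_fiberFinset, hv]
      have h2 := List.mem_map_of_mem (f := f) h1
      rw [h] at h2
      simpa [mem_fiberFinset] using h2
  · intro v w hvw hn hlt
    obtain ⟨x, hx⟩ := Option.ne_none_iff_exists'.1 hn
    have hs : (((fiberFinset l (some x)).sort (· ≤ ·)).map f).Pairwise (· < ·) := by
      rw [h]
      exact Finset.sortedLT_sort _ |>.pairwise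
    rw [List.pairwise_map, List.pairwise_iff_getElem] at hs
    have hv' : v ∈ (fiberFinset l (some x)).sort (· ≤ ·) := by simp [mem_fiberFinset, hx]
    have hw' : w ∈ (fiberFinset l (some x)).sort (· ≤ ·) := by simp [mem_fiberFinset, ← hvw, hx]
    obtain ⟨i, hi, rfl⟩ := List.getElem_of_mem hv'
    obtain ⟨j, hj, rfl⟩ := List.getElem_of_mem hw'
    refine hs i j hi hj ?_
    by_contra hij
    have := (Finset.sortedLT_sort (fiberFinset l (some x))).sortedLE.getElem_le_getElem_of_le
      (hi := hj) (hj := hi) (not_lt.1 hij)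
    exact absurd this hlt.not_ge

end FibreMap

namespace TypedHypergraph

variable {S : HypSignature.{u}} {m n p q r s m' n' p' q' : ℕ}

/-! ### Inputs and outputs -/

theorem ofFn_input (F : TypedHypergraph S m n) : List.ofFn F.input = F.inputs := by
  apply List.ext_getElem
  · simp [LinearHypergraph.inputs, F.card_inputs]
  · intro i h1 h2
    simp [input, LinearHypergraph.inputs, Finset.orderEmbOfFin_apply]

theorem ofFn_output (F : TypedHypergraph S m n) : List.ofFn F.output = F.outputs := by
  apply List.ext_getElem
  · simp [LinearHypergraph.outputs, F.card_outputs]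
  · intro i h1 h2
    simp [output, LinearHypergraph.outputs, Finset.orderEmbOfFin_apply]

theorem input_strictMono (F : TypedHypergraph S m n) : StrictMono F.input :=
  (F.inputSet.orderEmbOfFin F.card_inputs).strictMono

theorem output_strictMono (F : TypedHypergraph S m n) : StrictMono F.output :=
  (F.outputSet.orderEmbOfFin F.card_outputs).strictMono

/-- A finite set has only one increasing enumeration by its cardinality. An increasing family of `m`
interface vertices is therefore the family of inputs, and exhaustion need not be proved. -/
theorem input_eq (F : TypedHypergraph S m n) {f : Fin m → F.Vt} (hf : StrictMono f)
    (h : ∀ i, F.left (f i) = none) (i : Fin m) : F.input i = f i :=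
  (congrFun (Finset.orderEmbOfFin_unique F.card_inputs (fun i => mem_fiberFinset.2 (h i)) hf)
    i).symm

theorem output_eq (F : TypedHypergraph S m n) {f : Fin n → F.Vs} (hf : StrictMono f)
    (h : ∀ i, F.right (f i) = none) (i : Fin n) : F.output i = f i :=
  (congrFun (Finset.orderEmbOfFin_unique F.card_outputs (fun i => mem_fiberFinset.2 (h i)) hf)
    i).symm

theorem exists_input (F : TypedHypergraph S m n) {v : F.Vt} (h : F.left v = none) :
    ∃ i, F.input i = v := ⟨F.inputIndex v h, by simp⟩

theorem exists_output (F : TypedHypergraph S m n) {v : F.Vs} (h : F.right v = none) :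
    ∃ i, F.output i = v := ⟨F.outputIndex v h, by simp⟩

/-! ### Isomorphisms up to a permutation of the interfaces -/

/-- An isomorphism of hypergraphs which sends the `i`th input to the `π i`th one and the `j`th
output to the `ρ j`th one. -/
structure WireIso (π : Fin m ≃ Fin m') (ρ : Fin n ≃ Fin n') (F : TypedHypergraph S m n)
    (G : TypedHypergraph S m' n') where
  /-- action on target vertices -/
  vt : F.Vt ≃ G.Vt
  /-- action on source vertices -/
  vs : F.Vs ≃ G.Vs
  /-- action on edges -/
  e : F.E ≃ G.E
  left : FibreMap F.left G.left e vt
  right : FibreMap F.right G.right e vs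
  input : ∀ i, vt (F.input i) = G.input (π i)
  output : ∀ j, vs (F.output j) = G.output (ρ j)
  conn : ∀ v, vs (F.conn v) = G.conn (vt v)
  label : ∀ x, G.label (e x) = F.label x

/-- Label and type dictate every fibre size; this is the source of automatic bijectivity. -/
theorem card_fiber_left (F : TypedHypergraph S m n) (x : Option F.E) :
    (fiberFinset F.left x).card = x.elim m (fun e => S.cod (F.label e)) := by
  cases x with
  | none => exact F.card_inputs
  | some e => simp [F.cod_label, LinearHypergraph.targets]

theorem card_fiber_right (F : TypedHypergraph S m n) (x : Option F.E) :
    (fiberFinset F.right x).card = x.elim n (fun e => S.dom (F.label e)) := by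
  cases x with
  | none => exact F.card_outputs
  | some e => simp [F.dom_label, LinearHypergraph.sources]

theorem bijective_of_left {F : TypedHypergraph S m n} {G : TypedHypergraph S m' n'}
    {π : Fin m ≃ Fin m'} {e : F.E ≃ G.E} {f : F.Vt → G.Vt} (hf : FibreMap F.left G.left e f)
    (hi : ∀ i, f (F.input i) = G.input (π i)) (he : ∀ x, G.label (e x) = F.label x) :
    Function.Bijective f := by
  refine hf.bijective ?_ ?_
  · intro v w hv hw h
    obtain ⟨i, rfl⟩ := F.exists_input hv
    obtain ⟨j, rfl⟩ := F.exists_input hw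
    rw [hi, hi] at h
    rw [π.injective (G.input_strictMono.injective h)]
  · intro x
    rw [card_fiber_left, card_fiber_left]
    cases x with
    | none => simpa using Fintype.card_congr π
    | some x => simp [he]

theorem bijective_of_right {F : TypedHypergraph S m n} {G : TypedHypergraph S m' n'}
    {π : Fin n ≃ Fin n'} {e : F.E ≃ G.E} {f : F.Vs → G.Vs} (hf : FibreMap F.right G.right e f)
    (hi : ∀ i, f (F.output i) = G.output (π i)) (he : ∀ x, G.label (e x) = F.label x) :
    Function.Bijective f := by
  refine hf.bijective ?_ ?_
  · intro v w hv hw h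
    obtain ⟨i, rfl⟩ := F.exists_output hv
    obtain ⟨j, rfl⟩ := F.exists_output hw
    rw [hi, hi] at h
    rw [π.injective (G.output_strictMono.injective h)]
  · intro x
    rw [card_fiber_right, card_fiber_right]
    cases x with
    | none => simpa using Fintype.card_congr π
    | some x => simp [he]

/-- Maps of vertices which are compatible with all the structure are automatically bijective. -/
noncomputable def WireIso.ofMaps {π : Fin m ≃ Fin m'} {ρ : Fin n ≃ Fin n'}
    {F : TypedHypergraph S m n} {G : TypedHypergraph S m' n'} (vt : F.Vt → G.Vt) (vs : F.Vs → G.Vs)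
    (e : F.E ≃ G.E) (left : FibreMap F.left G.left e vt) (right : FibreMap F.right G.right e vs)
    (input : ∀ i, vt (F.input i) = G.input (π i)) (output : ∀ j, vs (F.output j) = G.output (ρ j))
    (conn : ∀ v, vs (F.conn v) = G.conn (vt v)) (label : ∀ x, G.label (e x) = F.label x) :
    WireIso π ρ F G where
  vt := Equiv.ofBijective vt (bijective_of_left left input label)
  vs := Equiv.ofBijective vs (bijective_of_right right output label)
  e := e
  left := left
  right := right
  input := input
  output := output
  conn := conn
  label := label

/-- A variant of `WireIso.ofMaps` with the map of source vertices in the other direction. -/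
noncomputable def WireIso.ofMaps' {π : Fin m ≃ Fin m'} {ρ : Fin n ≃ Fin n'}
    {F : TypedHypergraph S m n} {G : TypedHypergraph S m' n'} (vt : F.Vt → G.Vt) (vs : G.Vs → F.Vs)
    (e : F.E ≃ G.E) (left : FibreMap F.left G.left e vt)
    (right : FibreMap G.right F.right e.symm vs)
    (input : ∀ i, vt (F.input i) = G.input (π i))
    (output : ∀ j, vs (G.output (ρ j)) = F.output j)
    (conn : ∀ v, F.conn v = vs (G.conn (vt v))) (label : ∀ x, G.label (e x) = F.label x) :
    WireIso π ρ F G where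
  vt := Equiv.ofBijective vt (bijective_of_left left input label)
  vs := (Equiv.ofBijective vs (bijective_of_right (π := ρ.symm) right
    (fun i => by rw [← output, Equiv.apply_symm_apply]) (fun x => by simp [← label]))).symm
  e := e
  left := left
  right := FibreMap.symm (e := e.symm)
    (f := Equiv.ofBijective vs (bijective_of_right (π := ρ.symm) right
    (fun i => by rw [← output, Equiv.apply_symm_apply]) (fun x => by simp [← label]))) right
  input := input
  output j := by rw [Equiv.symm_apply_eq]; exact (output j).symm
  conn v := by rw [Equiv.symm_apply_eq]; exact conn v
  label := label

namespace WireIso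

/-- The identity isomorphism. -/
def refl (F : TypedHypergraph S m n) : WireIso (Equiv.refl _) (Equiv.refl _) F F where
  vt := Equiv.refl _
  vs := Equiv.refl _
  e := Equiv.refl _
  left := FibreMap.id _
  right := FibreMap.id _
  input _ := rfl
  output _ := rfl
  conn _ := rfl
  label _ := rfl

/-- Composition of isomorphisms. -/
def trans {k l : ℕ} {π : Fin m ≃ Fin m'} {ρ : Fin n ≃ Fin n'} {π' : Fin m' ≃ Fin k}
    {ρ' : Fin n' ≃ Fin l}
    {F : TypedHypergraph S m n} {G : TypedHypergraph S m' n'} {H : TypedHypergraph S k l}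
    (h : WireIso π ρ F G) (h' : WireIso π' ρ' G H) :
    WireIso (π.trans π') (ρ.trans ρ') F H where
  vt := h.vt.trans h'.vt
  vs := h.vs.trans h'.vs
  e := h.e.trans h'.e
  left := h'.left.comp h.left
  right := h'.right.comp h.right
  input i := by simp [h.input, h'.input]
  output i := by simp [h.output, h'.output]
  conn i := by simp [h.conn, h'.conn]
  label i := by simp [h.label, h'.label]

/-- The inverse isomorphism. -/
def symm {π : Fin m ≃ Fin m'} {ρ : Fin n ≃ Fin n'} {F : TypedHypergraph S m n}
    {G : TypedHypergraph S m' n'} (h : WireIso π ρ F G) : WireIso π.symm ρ.symm G F where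
  vt := h.vt.symm
  vs := h.vs.symm
  e := h.e.symm
  left := h.left.symm
  right := h.right.symm
  input i := by simp [Equiv.symm_apply_eq, h.input]
  output i := by simp [Equiv.symm_apply_eq, h.output]
  conn i := by simp [Equiv.symm_apply_eq, h.conn]
  label i := by simp [← h.label]

/-- Replace the permutations by equal ones. -/
def congr {π π' : Fin m ≃ Fin m'} {ρ ρ' : Fin n ≃ Fin n'} {F : TypedHypergraph S m n}
    {G : TypedHypergraph S m' n'} (h : WireIso π ρ F G) (hπ : ∀ i, (π i : ℕ) = π' i)
    (hρ : ∀ i, (ρ i : ℕ) = ρ' i) : WireIso π' ρ' F G :=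
  (Equiv.ext fun i => Fin.ext (hπ i) : π = π') ▸ (Equiv.ext fun i => Fin.ext (hρ i) : ρ = ρ') ▸ h

/-- Transport along equalities of the types. -/
def ofCast (F : TypedHypergraph S m n) (hm : m = m') (hn : n = n') :
    WireIso (finCongr hm.symm) (finCongr hn.symm) (TypedHypergraph.cast hm hn F) F := by
  subst hm hn
  exact refl F

end WireIso

/-- Equality of the ordered interface lists is equality of their entries position by position, by
`ofFn_input` and `ofFn_output`; for edges the lists are traded for the order condition of
`FibreMap`. -/
theorem hypIso_iff {F G : TypedHypergraph S m n} :
    HypIso F.toLabelledHypergraph G.toLabelledHypergraph ↔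
      Nonempty (WireIso (Equiv.refl _) (Equiv.refl _) F G) := by
  constructor
  · rintro ⟨h, h1, h2, h3, h4, h5⟩
    refine ⟨⟨Equiv.ofBijective _ h1, Equiv.ofBijective _ h2, Equiv.ofBijective _ h3,
      FibreMap.of_sort_map h.targets_map h4, FibreMap.of_sort_map h.sources_map h5, ?_, ?_,
      h.conn_map, h.label_map⟩⟩
    · rw [← ofFn_input, ← ofFn_input, List.map_ofFn, List.ofFn_inj] at h4
      exact congrFun h4
    · rw [← ofFn_output, ← ofFn_output, List.map_ofFn, List.ofFn_inj] at h5
      exact congrFun h5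
  · rintro ⟨h⟩
    refine ⟨⟨h.vt, h.vs, h.e, h.right.sort_map, h.left.sort_map, h.conn, h.label⟩,
      h.vt.bijective, h.vs.bijective, h.e.bijective, ?_, ?_⟩
    · rw [← ofFn_input, ← ofFn_input, List.map_ofFn, List.ofFn_inj]
      exact funext h.input
    · rw [← ofFn_output, ← ofFn_output, List.map_ofFn, List.ofFn_inj]
      exact funext h.output

end TypedHypergraph

/-! ### Block sums and block transpositions of interface positions. -/

/-- The block sum of two bijections. -/
def finSumCongr {m m' n n' : ℕ} (π : Fin m ≃ Fin m') (ρ : Fin n ≃ Fin n') :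
    Fin (m + n) ≃ Fin (m' + n') :=
  (finSumFinEquiv.symm.trans (π.sumCongr ρ)).trans finSumFinEquiv

@[simp] theorem finSumCongr_castAdd {m m' n n' : ℕ} (π : Fin m ≃ Fin m') (ρ : Fin n ≃ Fin n')
    (i : Fin m) : finSumCongr π ρ (Fin.castAdd n i) = Fin.castAdd n' (π i) := by
  simp [finSumCongr]

@[simp] theorem finSumCongr_natAdd {m m' n n' : ℕ} (π : Fin m ≃ Fin m') (ρ : Fin n ≃ Fin n')
    (i : Fin n) : finSumCongr π ρ (Fin.natAdd m i) = Fin.natAdd m' (ρ i) := by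
  simp [finSumCongr]

@[simp] theorem finSumCongr_symm {m m' n n' : ℕ} (π : Fin m ≃ Fin m') (ρ : Fin n ≃ Fin n') :
    (finSumCongr π ρ).symm = finSumCongr π.symm ρ.symm := rfl

theorem finSumCongr_val {m m' n n' : ℕ} (π : Fin m ≃ Fin m') (ρ : Fin n ≃ Fin n')
    (i : Fin (m + n)) : (finSumCongr π ρ i : ℕ) =
      if h : (i : ℕ) < m then (π ⟨i, h⟩ : ℕ) else m' + ρ ⟨i - m, by omega⟩ := by
  induction i using Fin.addCases with
  | left i => simp
  | right i =>
    rw [finSumCongr_natAdd, dif_neg (by simp)]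
    simp

theorem finAddFlip_val {m n : ℕ} (i : Fin (m + n)) :
    (finAddFlip i : ℕ) = if (i : ℕ) < m then n + i else i - m := by
  induction i using Fin.addCases with
  | left i => simp
  | right i =>
    rw [finAddFlip_apply_natAdd, if_neg (by simp)]
    simp

namespace TypedHypergraph

variable {S : HypSignature.{u}} {m n p q r s m' n' p' q' : ℕ}

/-! ### Inputs, outputs and connections of composites and tensors -/

theorem strictMono_addCases {V : Type} [Preorder V] {f : Fin m → V} {g : Fin n → V}
    (hf : StrictMono f) (hg : StrictMono g) (h : ∀ i j, f i < g j) :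
    StrictMono (Fin.addCases f g : Fin (m + n) → V) := by
  intro i j hij
  induction i using Fin.addCases with
  | left i =>
    induction j using Fin.addCases with
    | left j => simpa using hf hij
    | right j => simpa using h i j
  | right i =>
    induction j using Fin.addCases with
    | left j =>
      have := Fin.lt_def.1 hij
      simp only [Fin.val_natAdd, Fin.val_castAdd] at this
      omega
    | right j =>
      have := Fin.lt_def.1 hij
      simp only [Fin.val_natAdd] at this
      simpa using hg (Fin.lt_def.2 (by omega))

theorem tensor_input (F : TypedHypergraph S m n) (G : TypedHypergraph S p q) (i : Fin (m + p)) :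
    (F.tensor G).input i = Fin.addCases (motive := fun _ => Lex (F.Vt ⊕ G.Vt))
      (fun i => toLex (Sum.inl (F.input i)))
      (fun i => toLex (Sum.inr (G.input i))) i := by
  apply input_eq (F.tensor G)
  · exact strictMono_addCases (V := Lex (F.Vt ⊕ G.Vt))
      (fun i j h => Sum.Lex.inl_lt_inl_iff.2 (F.input_strictMono h))
      (fun i j h => Sum.Lex.inr_lt_inr_iff.2 (G.input_strictMono h))
      (fun i j => Sum.Lex.inl_lt_inr _ _)
  · intro i
    change sumIncidence F.left G.left _ = none
    induction i using Fin.addCases with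
    | left i =>
      rw [Fin.addCases_left]
      exact congrArg (Option.map Sum.inl) (F.left_input i)
    | right i =>
      rw [Fin.addCases_right]
      exact congrArg (Option.map Sum.inr) (G.left_input i)

theorem tensor_output (F : TypedHypergraph S m n) (G : TypedHypergraph S p q) (i : Fin (n + q)) :
    (F.tensor G).output i = Fin.addCases (motive := fun _ => Lex (F.Vs ⊕ G.Vs))
      (fun i => toLex (Sum.inl (F.output i)))
      (fun i => toLex (Sum.inr (G.output i))) i := by
  apply output_eq (F.tensor G)
  · exact strictMono_addCases (V := Lex (F.Vs ⊕ G.Vs))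
      (fun i j h => Sum.Lex.inl_lt_inl_iff.2 (F.output_strictMono h))
      (fun i j h => Sum.Lex.inr_lt_inr_iff.2 (G.output_strictMono h))
      (fun i j => Sum.Lex.inl_lt_inr _ _)
  · intro i
    change sumIncidence F.right G.right _ = none
    induction i using Fin.addCases with
    | left i =>
      rw [Fin.addCases_left]
      exact congrArg (Option.map Sum.inl) (F.right_output i)
    | right i =>
      rw [Fin.addCases_right]
      exact congrArg (Option.map Sum.inr) (G.right_output i)

@[simp] theorem tensor_input_castAdd (F : TypedHypergraph S m n) (G : TypedHypergraph S p q)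
    (i : Fin m) : (F.tensor G).input (Fin.castAdd p i) = toLex (Sum.inl (F.input i)) :=
  (tensor_input F G _).trans (Fin.addCases_left _)

@[simp] theorem tensor_input_natAdd (F : TypedHypergraph S m n) (G : TypedHypergraph S p q)
    (i : Fin p) : (F.tensor G).input (Fin.natAdd m i) = toLex (Sum.inr (G.input i)) :=
  (tensor_input F G _).trans (Fin.addCases_right _)

@[simp] theorem tensor_output_castAdd (F : TypedHypergraph S m n) (G : TypedHypergraph S p q)
    (i : Fin n) : (F.tensor G).output (Fin.castAdd q i) = toLex (Sum.inl (F.output i)) :=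
  (tensor_output F G _).trans (Fin.addCases_left _)

@[simp] theorem tensor_output_natAdd (F : TypedHypergraph S m n) (G : TypedHypergraph S p q)
    (i : Fin q) : (F.tensor G).output (Fin.natAdd n i) = toLex (Sum.inr (G.output i)) :=
  (tensor_output F G _).trans (Fin.addCases_right _)

@[simp] theorem comp_input (F : TypedHypergraph S m n) (G : TypedHypergraph S n p) (i : Fin m) :
    (F.comp G).input i = toLex (Sum.inl (F.input i)) :=
  input_eq (F.comp G) (f := fun i => toLex (Sum.inl (F.input i)))
    (fun _ _ h => Sum.Lex.inl_lt_inl_iff.2 (F.input_strictMono h))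
    (fun i => congrArg (Option.map Sum.inl) (F.left_input i)) i

@[simp] theorem comp_output (F : TypedHypergraph S m n) (G : TypedHypergraph S n p) (i : Fin p) :
    (F.comp G).output i = toLex (Sum.inr (G.output i)) :=
  output_eq (F.comp G) (f := fun i => toLex (Sum.inr (G.output i)))
    (fun _ _ h => Sum.Lex.inr_lt_inr_iff.2 (G.output_strictMono h))
    (fun i => congrArg (Option.map Sum.inr) (G.right_output i)) i

theorem comp_conn_inl_of_ne (F : TypedHypergraph S m n) (G : TypedHypergraph S n p) {v : F.Vt}
    (h : F.right (F.conn v) ≠ none) :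
    (F.comp G).conn (toLex (Sum.inl v)) = toLex (Sum.inl ⟨F.conn v, h⟩) :=
  congrArg toLex (dif_neg h)

/-- Replaces the index `outputIndex` chosen inside `compConn` by any index known to work, so that
gluing can be computed wire by wire. -/
theorem comp_conn_inl_of_eq (F : TypedHypergraph S m n) (G : TypedHypergraph S n p) {v : F.Vt}
    {i : Fin n} (h : F.conn v = F.output i) :
    (F.comp G).conn (toLex (Sum.inl v)) = toLex (Sum.inr (G.conn (G.input i))) := by
  have h' : F.right (F.conn v) = none := by rw [h]; exact F.right_output i
  refine congrArg toLex ((dif_pos h').trans ?_)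
  congr 3
  simp [h]

theorem edgeless_input (σ : Equiv.Perm (Fin n)) (i : Fin n) : (edgeless S n σ).input i = i :=
  input_eq (edgeless S n σ) (f := fun i => i) strictMono_id (fun _ => rfl) i

theorem edgeless_output (σ : Equiv.Perm (Fin n)) (i : Fin n) : (edgeless S n σ).output i = i :=
  output_eq (edgeless S n σ) (f := fun i => i) strictMono_id (fun _ => rfl) i

theorem identity_input (i : Fin n) : (identity S n).input i = i := edgeless_input _ i

theorem identity_output (i : Fin n) : (identity S n).output i = i := edgeless_output _ i

theorem identity_conn_input (i : Fin n) :
    (identity S n).conn ((identity S n).input i) = (identity S n).output i := by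
  rw [identity_input, identity_output]
  rfl

theorem identity_exists_input (v : (identity S n).Vt) : ∃ i, (identity S n).input i = v :=
  exists_input _ rfl

/-! ### Congruence -/

namespace WireIso

/-- Composition respects isomorphism. -/
noncomputable def comp {π : Fin m ≃ Fin m'} {ρ : Fin n ≃ Fin n'} {τ : Fin p ≃ Fin p'}
    {F : TypedHypergraph S m n} {F' : TypedHypergraph S m' n'} {G : TypedHypergraph S n p}
    {G' : TypedHypergraph S n' p'} (h : WireIso π ρ F F') (k : WireIso ρ τ G G') :
    WireIso π τ (F.comp G) (F'.comp G') :=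
  have hk : ∀ v : {v : G.Vt // G.left v ≠ none}, G'.left (k.vt v.1) ≠ none := fun v => by
    simpa [k.left.map] using v.2
  have hh : ∀ v : {v : F.Vs // F.right v ≠ none}, F'.right (h.vs v.1) ≠ none := fun v => by
    simpa [h.right.map] using v.2
  ofMaps (fun v => toLex (Sum.map h.vt (fun v => ⟨k.vt v.1, hk v⟩) (ofLex v)))
    (fun v => toLex (Sum.map (fun v => ⟨h.vs v.1, hh v⟩) k.vs (ofLex v)))
    (Equiv.sumCongr h.e k.e)
    (FibreMap.sumMap h.left ((k.left.comp (FibreMap.val _ _)).codRestrict _ hk))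
    (FibreMap.sumMap ((h.right.comp (FibreMap.val _ _)).codRestrict _ hh) k.right)
    (fun i => by
      rw [comp_input, comp_input, ← h.input]; rfl)
    (fun i => by
      rw [comp_output, comp_output, ← k.output]; rfl)
    (by
      rintro (v | v)
      -- Glued wire `i` is carried to glued wire `ρ i`. As `ρ` acts on the outputs of `F` and on the
      -- inputs of `G` alike, any permutation of the middle interface is harmless.
      · by_cases hv : F.right (F.conn v) = none
        · obtain ⟨i, hi⟩ := F.exists_output hv
          have h1 := comp_conn_inl_of_eq F G hi.symm
          have h2 : F'.conn (h.vt v) = F'.output (ρ i) := by rw [← h.conn, ← hi, h.output]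
          refine (congrArg _ h1).trans ((comp_conn_inl_of_eq F' G' h2).trans ?_).symm
          refine congrArg (fun x => toLex (Sum.inr x)) ?_
          rw [← k.input, ← k.conn]
        · have h1 := comp_conn_inl_of_ne F G hv
          have h2 : F'.right (F'.conn (h.vt v)) ≠ none := by
            rw [← h.conn]; exact hh ⟨_, hv⟩
          refine (congrArg _ h1).trans ((comp_conn_inl_of_ne F' G' h2).trans ?_).symm
          refine congrArg (fun x => toLex (Sum.inl x)) (Subtype.ext ?_)
          exact (h.conn v).symm
      · exact congrArg (fun x => toLex (Sum.inr x)) (k.conn v.1))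
    (by
      rintro (x | x)
      exacts [h.label x, k.label x])

/-- The tensor product respects isomorphism. -/
noncomputable def tensor {π : Fin m ≃ Fin m'} {ρ : Fin n ≃ Fin n'} {π' : Fin p ≃ Fin p'}
    {ρ' : Fin q ≃ Fin q'}
    {F : TypedHypergraph S m n} {F' : TypedHypergraph S m' n'} {G : TypedHypergraph S p q}
    {G' : TypedHypergraph S p' q'} (h : WireIso π ρ F F') (k : WireIso π' ρ' G G') :
    WireIso (finSumCongr π π') (finSumCongr ρ ρ') (F.tensor G) (F'.tensor G') :=
  ofMaps (fun v => toLex (Sum.map h.vt k.vt (ofLex v)))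
    (fun v => toLex (Sum.map h.vs k.vs (ofLex v)))
    (Equiv.sumCongr h.e k.e)
    (FibreMap.sumMap h.left k.left) (FibreMap.sumMap h.right k.right)
    (fun i => by
      induction i using Fin.addCases with
      | left i =>
        rw [finSumCongr_castAdd, tensor_input_castAdd, tensor_input_castAdd, ← h.input]; rfl
      | right i =>
        rw [finSumCongr_natAdd, tensor_input_natAdd, tensor_input_natAdd, ← k.input]; rfl)
    (fun i => by
      induction i using Fin.addCases with
      | left i =>
        rw [finSumCongr_castAdd, tensor_output_castAdd, tensor_output_castAdd, ← h.output]; rfl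
      | right i =>
        rw [finSumCongr_natAdd, tensor_output_natAdd, tensor_output_natAdd, ← k.output]; rfl)
    (by
      rintro (v | v)
      exacts [congrArg (fun x => toLex (Sum.inl x)) (h.conn v),
        congrArg (fun x => toLex (Sum.inr x)) (k.conn v)])
    (by
      rintro (x | x)
      exacts [h.label x, k.label x])

end WireIso

namespace WireIso

/-! ### Category and monoidal laws -/

/-- The identity is a left unit. -/
noncomputable def idComp (F : TypedHypergraph S m n) :
    WireIso (Equiv.refl _) (Equiv.refl _) ((identity S m).comp F) F :=
  have he : IsEmpty {v : (identity S m).Vs // (identity S m).right v ≠ none} :=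
    ⟨fun v => v.2 rfl⟩
  -- The inputs of the identity take the place of the deleted inputs of `F`; all source vertices of
  -- the identity have been deleted.
  ofMaps (fun v => Sum.elim F.input Subtype.val (ofLex v))
    (fun v => Sum.elim he.elim _root_.id (ofLex v))
    (Equiv.emptySum Empty F.E)
    (by
      refine FibreMap.congr
        (FibreMap.sumElim (E := (identity S m).E) (e := Empty.elim) (f := F.input)
        (FibreMap.of_none (fun _ => rfl) F.left_input)
          (FibreMap.val F.left (fun v => F.left v ≠ none))) ?_
      rintro (x | x)
      exacts [x.elim, rfl])
    (by
      refine FibreMap.congr (FibreMap.sumElim (E := (identity S m).E) (e := Empty.elim)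
        (l := fun v : {v : (identity S m).Vs // (identity S m).right v ≠ none} =>
          (identity S m).right v.1) (f := he.elim)
        FibreMap.of_isEmpty (FibreMap.id F.right)) ?_
      rintro (x | x)
      exacts [x.elim, rfl])
    (fun i => by
      rw [comp_input, identity_input]; rfl)
    (fun i => by
      rw [comp_output]; rfl)
    (by
      rintro (v | v)
      · obtain ⟨i, rfl⟩ := identity_exists_input v
        refine (congrArg _ (comp_conn_inl_of_eq _ F (identity_conn_input i))).trans ?_
        show F.conn (F.input i) = F.conn (F.input _)
        rw [identity_input]
      · rfl)
    (by
      rintro (x | x)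
      exacts [x.elim, rfl])

/-- The identity is a right unit. -/
noncomputable def compId (F : TypedHypergraph S m n) :
    WireIso (Equiv.refl _) (Equiv.refl _) (F.comp (identity S n)) F :=
  have he : IsEmpty {v : (identity S n).Vt // (identity S n).left v ≠ none} :=
    ⟨fun v => v.2 rfl⟩
  ofMaps (fun v => Sum.elim _root_.id he.elim (ofLex v))
    (fun v => Sum.elim Subtype.val F.output (ofLex v))
    (Equiv.sumEmpty F.E Empty)
    (by
      refine FibreMap.congr (FibreMap.sumElim (E' := (identity S n).E) (e' := Empty.elim)
        (l' := fun v : {v : (identity S n).Vt // (identity S n).left v ≠ none} =>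
          (identity S n).left v.1) (g := he.elim)
        (FibreMap.id F.left) FibreMap.of_isEmpty) ?_
      rintro (x | x)
      exacts [rfl, x.elim])
    (by
      refine FibreMap.congr
        (FibreMap.sumElim (E' := (identity S n).E) (e' := Empty.elim) (g := F.output)
        (FibreMap.val F.right (fun v => F.right v ≠ none))
        (FibreMap.of_none (fun _ => rfl) F.right_output)) ?_
      rintro (x | x)
      exacts [rfl, x.elim])
    (fun i => by
      rw [comp_input]; rfl)
    (fun i => by
      rw [comp_output, identity_output]; rfl)
    (by
      rintro (v | v)
      · by_cases hv : F.right (F.conn v) = none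
        · obtain ⟨i, hi⟩ := F.exists_output hv
          refine (congrArg _ (comp_conn_inl_of_eq F (identity S n) hi.symm)).trans ?_
          rw [identity_conn_input, identity_output]
          exact hi
        · exact congrArg _ (comp_conn_inl_of_ne F (identity S n) hv)
      · exact he.elim v)
    (by
      rintro (x | x)
      exacts [rfl, x.elim])

/-- Composition is associative. -/
noncomputable def compAssoc (F : TypedHypergraph S m n) (G : TypedHypergraph S n p)
    (H : TypedHypergraph S p q) :
    WireIso (Equiv.refl _) (Equiv.refl _) ((F.comp G).comp H) (F.comp (G.comp H)) :=
  have h1 : ∀ v : {v : G.Vt // G.left v ≠ none},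
      (G.comp H).left (toLex (Sum.inl v.1)) ≠ none := fun v h => v.2 (Option.map_eq_none_iff.1 h)
  have h2 : ∀ v : {v : H.Vt // H.left v ≠ none},
      (G.comp H).left (toLex (Sum.inr v)) ≠ none := fun v h => v.2 (Option.map_eq_none_iff.1 h)
  have h3 : ∀ v : {v : F.Vs // F.right v ≠ none},
      (F.comp G).right (toLex (Sum.inl v)) ≠ none := fun v h => v.2 (Option.map_eq_none_iff.1 h)
  have h4 : ∀ v : {v : G.Vs // G.right v ≠ none},
      (F.comp G).right (toLex (Sum.inr v.1)) ≠ none := fun v h => v.2 (Option.map_eq_none_iff.1 h)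
  -- On source vertices the simple direction is from right to left: each summand there embeds into a
  -- subtype of a sum, whereas the inverse would have to take such a subtype apart.
  ofMaps' (fun v => Sum.elim (fun v => Sum.elim (fun v => toLex (Sum.inl v))
      (fun v => toLex (Sum.inr ⟨toLex (Sum.inl v.1), h1 v⟩)) (ofLex v))
      (fun v => toLex (Sum.inr ⟨toLex (Sum.inr v), h2 v⟩)) (ofLex v))
    (fun v => Sum.elim (fun v => toLex (Sum.inl ⟨toLex (Sum.inl v), h3 v⟩))
      (fun v => Sum.elim (fun v => toLex (Sum.inl ⟨toLex (Sum.inr v.1), h4 v⟩))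
      (fun v => toLex (Sum.inr v)) (ofLex v)) (ofLex v))
    (Equiv.sumAssoc F.E G.E H.E)
    (by
      refine FibreMap.congr (FibreMap.sumElim (FibreMap.sumElim (FibreMap.inl F.left _)
        ((FibreMap.inr F.left _).comp (((FibreMap.inl G.left _).comp (FibreMap.val G.left
          (fun v => G.left v ≠ none))).codRestrict (fun v => (G.comp H).left v ≠ none) h1)))
        ((FibreMap.inr F.left _).comp ((FibreMap.inr G.left _).codRestrict
          (fun v => (G.comp H).left v ≠ none) h2))) ?_
      rintro ((x | x) | x) <;> rfl)
    (by
      refine FibreMap.congr (FibreMap.sumElim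
        ((FibreMap.inl _ H.right).comp ((FibreMap.inl _ G.right).codRestrict
          (fun v => (F.comp G).right v ≠ none) h3))
        (FibreMap.sumElim
        ((FibreMap.inl _ H.right).comp (((FibreMap.inr _ G.right).comp (FibreMap.val G.right
          (fun v => G.right v ≠ none))).codRestrict (fun v => (F.comp G).right v ≠ none) h4))
          (FibreMap.inr _ H.right))) ?_
      rintro (x | (x | x)) <;> rfl)
    (fun i => by
      rw [comp_input, comp_input, comp_input]; rfl)
    (fun i => by
      rw [comp_output, comp_output, comp_output]; rfl)
    (by
      rintro ((v | v) | v)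
      -- A connection that starts in `F` stops in `F`, or crosses to `G` and stops there, or crosses
      -- both interfaces; each case computes the same endpoint for both bracketings.
      · by_cases hv : F.right (F.conn v) = none
        · obtain ⟨i, hi⟩ := F.exists_output hv
          have e1 := comp_conn_inl_of_eq F G hi.symm
          have e2 := comp_conn_inl_of_eq F (G.comp H) hi.symm
          rw [comp_input] at e2
          refine Eq.trans ?_ (congrArg _ e2).symm
          by_cases hw : G.right (G.conn (G.input i)) = none
          · obtain ⟨j, hj⟩ := G.exists_output hw
            have e3 := comp_conn_inl_of_eq G H hj.symm
            refine Eq.trans ?_ (congrArg (fun x => Sum.elim _ _ (toLex (Sum.inr x))) e3).symm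
            have e4 : (F.comp G).conn (toLex (Sum.inl v)) = (F.comp G).output j := by
              rw [e1, comp_output, hj]
            exact comp_conn_inl_of_eq (F.comp G) H e4
          · have e3 := comp_conn_inl_of_ne G H hw
            refine Eq.trans ?_ (congrArg (fun x => Sum.elim _ _ (toLex (Sum.inr x))) e3).symm
            have e4 : (F.comp G).right ((F.comp G).conn (toLex (Sum.inl v))) ≠ none := by
              rw [e1]; exact h4 ⟨_, hw⟩
            refine (comp_conn_inl_of_ne (F.comp G) H e4).trans ?_
            exact congrArg (fun x => toLex (Sum.inl x)) (Subtype.ext e1)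
        · have e1 := comp_conn_inl_of_ne F G hv
          have e2 := comp_conn_inl_of_ne F (G.comp H) hv
          refine Eq.trans ?_ (congrArg _ e2).symm
          have e4 : (F.comp G).right ((F.comp G).conn (toLex (Sum.inl v))) ≠ none := by
            rw [e1]; exact h3 ⟨_, hv⟩
          refine (comp_conn_inl_of_ne (F.comp G) H e4).trans ?_
          exact congrArg (fun x => toLex (Sum.inl x)) (Subtype.ext e1)
      · have e1 : (F.comp G).conn (toLex (Sum.inr v)) = toLex (Sum.inr (G.conn v.1)) := rfl
        have e2 : (F.comp (G.comp H)).conn (toLex (Sum.inr ⟨toLex (Sum.inl v.1), h1 v⟩)) =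
          toLex (Sum.inr ((G.comp H).conn (toLex (Sum.inl v.1)))) := rfl
        refine Eq.trans ?_ (congrArg _ e2).symm
        by_cases hw : G.right (G.conn v.1) = none
        · obtain ⟨j, hj⟩ := G.exists_output hw
          have e3 := comp_conn_inl_of_eq G H hj.symm
          refine Eq.trans ?_ (congrArg (fun x => Sum.elim _ _ (toLex (Sum.inr x))) e3).symm
          have e4 : (F.comp G).conn (toLex (Sum.inr v)) = (F.comp G).output j := by
            rw [e1, comp_output, hj]
          exact comp_conn_inl_of_eq (F.comp G) H e4
        · have e3 := comp_conn_inl_of_ne G H hw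
          refine Eq.trans ?_ (congrArg (fun x => Sum.elim _ _ (toLex (Sum.inr x))) e3).symm
          have e4 : (F.comp G).right ((F.comp G).conn (toLex (Sum.inr v))) ≠ none := by
            rw [e1]; exact h4 ⟨_, hw⟩
          refine (comp_conn_inl_of_ne (F.comp G) H e4).trans ?_
          exact congrArg (fun x => toLex (Sum.inl x)) (Subtype.ext e1)
      · rfl)
    (by
      rintro ((x | x) | x) <;> rfl)

/-- The interchange law. -/
noncomputable def tensorComp (F : TypedHypergraph S m n) (G : TypedHypergraph S r s)
    (H : TypedHypergraph S n p) (K : TypedHypergraph S s q) :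
    WireIso (Equiv.refl _) (Equiv.refl _) ((F.comp H).tensor (G.comp K))
      ((F.tensor G).comp (H.tensor K)) :=
  have h1 : ∀ v : {v : H.Vt // H.left v ≠ none},
      (H.tensor K).left (toLex (Sum.inl v.1)) ≠ none := fun v h => v.2 (Option.map_eq_none_iff.1 h)
  have h2 : ∀ v : {v : K.Vt // K.left v ≠ none},
      (H.tensor K).left (toLex (Sum.inr v.1)) ≠ none := fun v h => v.2 (Option.map_eq_none_iff.1 h)
  have h3 : ∀ v : {v : F.Vs // F.right v ≠ none},
      (F.tensor G).right (toLex (Sum.inl v.1)) ≠ none := fun v h => v.2 (Option.map_eq_none_iff.1 h)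
  have h4 : ∀ v : {v : G.Vs // G.right v ≠ none},
      (F.tensor G).right (toLex (Sum.inr v.1)) ≠ none := fun v h => v.2 (Option.map_eq_none_iff.1 h)
  ofMaps (fun v => Sum.elim
      (fun v => Sum.elim (fun v => toLex (Sum.inl (toLex (Sum.inl v))))
        (fun v => toLex (Sum.inr ⟨toLex (Sum.inl v.1), h1 v⟩)) (ofLex v))
      (fun v => Sum.elim (fun v => toLex (Sum.inl (toLex (Sum.inr v))))
        (fun v => toLex (Sum.inr ⟨toLex (Sum.inr v.1), h2 v⟩)) (ofLex v)) (ofLex v))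
    (fun v => Sum.elim
      (fun v => Sum.elim (fun v => toLex (Sum.inl ⟨toLex (Sum.inl v.1), h3 v⟩))
        (fun v => toLex (Sum.inr (toLex (Sum.inl v)))) (ofLex v))
      (fun v => Sum.elim (fun v => toLex (Sum.inl ⟨toLex (Sum.inr v.1), h4 v⟩))
        (fun v => toLex (Sum.inr (toLex (Sum.inr v)))) (ofLex v)) (ofLex v))
    -- The vertices come in the order `F`, `H`, `G`, `K` on one side and `F`, `G`, `H`, `K` on the
    -- other. This does no harm, since order matters only within an edge or within the interface.
    (Equiv.sumSumSumComm F.E H.E G.E K.E)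
    (by
      refine FibreMap.congr (FibreMap.sumElim
        (FibreMap.sumElim
          ((FibreMap.inl _ (fun v : {v // (H.tensor K).left v ≠ none} =>
            (H.tensor K).left v.1)).comp (FibreMap.inl F.left G.left))
          ((FibreMap.inr (F.tensor G).left _).comp (((FibreMap.inl H.left K.left).comp
            (FibreMap.val _ (fun v => H.left v ≠ none))).codRestrict
              (fun v => (H.tensor K).left v ≠ none) h1)))
        (FibreMap.sumElim
          ((FibreMap.inl _ (fun v : {v // (H.tensor K).left v ≠ none} =>
            (H.tensor K).left v.1)).comp (FibreMap.inr F.left G.left))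
          ((FibreMap.inr (F.tensor G).left _).comp (((FibreMap.inr H.left K.left).comp
            (FibreMap.val _ (fun v => K.left v ≠ none))).codRestrict
              (fun v => (H.tensor K).left v ≠ none) h2)))) ?_
      rintro ((x | x) | (x | x)) <;> rfl)
    (by
      refine FibreMap.congr (FibreMap.sumElim
        (FibreMap.sumElim
          ((FibreMap.inl _ (H.tensor K).right).comp (((FibreMap.inl F.right G.right).comp
            (FibreMap.val _ (fun v => F.right v ≠ none))).codRestrict
              (fun v => (F.tensor G).right v ≠ none) h3))
          ((FibreMap.inr (fun v : {v // (F.tensor G).right v ≠ none} =>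
            (F.tensor G).right v.1) _).comp (FibreMap.inl H.right K.right)))
        (FibreMap.sumElim
          ((FibreMap.inl _ (H.tensor K).right).comp (((FibreMap.inr F.right G.right).comp
            (FibreMap.val _ (fun v => G.right v ≠ none))).codRestrict
              (fun v => (F.tensor G).right v ≠ none) h4))
          ((FibreMap.inr (fun v : {v // (F.tensor G).right v ≠ none} =>
            (F.tensor G).right v.1) _).comp (FibreMap.inr H.right K.right)))) ?_
      rintro ((x | x) | (x | x)) <;> rfl)
    (fun i => by
      induction i using Fin.addCases with
      | left i =>
        rw [Equiv.refl_apply, tensor_input_castAdd, comp_input, comp_input, tensor_input_castAdd]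
        rfl
      | right i =>
        rw [Equiv.refl_apply, tensor_input_natAdd, comp_input, comp_input, tensor_input_natAdd]
        rfl)
    (fun i => by
      induction i using Fin.addCases with
      | left i =>
        rw [Equiv.refl_apply, tensor_output_castAdd, comp_output, comp_output,
          tensor_output_castAdd]
        rfl
      | right i =>
        rw [Equiv.refl_apply, tensor_output_natAdd, comp_output, comp_output,
          tensor_output_natAdd]
        rfl)
    (by
      rintro ((v | v) | (v | v))
      · have e0 : (F.tensor G).conn (toLex (Sum.inl v)) = toLex (Sum.inl (F.conn v)) := rfl
        by_cases hv : F.right (F.conn v) = none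
        · obtain ⟨i, hi⟩ := F.exists_output hv
          have e1 := comp_conn_inl_of_eq F H hi.symm
          have e2 : (F.tensor G).conn (toLex (Sum.inl v)) = (F.tensor G).output
              (Fin.castAdd s i) := by
            rw [tensor_output_castAdd, e0, hi]
          have e3 := comp_conn_inl_of_eq (F.tensor G) (H.tensor K) e2
          rw [tensor_input_castAdd] at e3
          exact (congrArg _ (congrArg (fun x => toLex (Sum.inl x)) e1)).trans e3.symm
        · have e1 := comp_conn_inl_of_ne F H hv
          have e2 : (F.tensor G).right ((F.tensor G).conn (toLex (Sum.inl v))) ≠ none := h3 ⟨_, hv⟩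
          have e3 := comp_conn_inl_of_ne (F.tensor G) (H.tensor K) e2
          exact (congrArg _ (congrArg (fun x => toLex (Sum.inl x)) e1)).trans e3.symm
      · rfl
      · have e0 : (F.tensor G).conn (toLex (Sum.inr v)) = toLex (Sum.inr (G.conn v)) := rfl
        by_cases hv : G.right (G.conn v) = none
        · obtain ⟨i, hi⟩ := G.exists_output hv
          have e1 := comp_conn_inl_of_eq G K hi.symm
          have e2 : (F.tensor G).conn (toLex (Sum.inr v)) = (F.tensor G).output
              (Fin.natAdd n i) := by
            rw [tensor_output_natAdd, e0, hi]
          have e3 := comp_conn_inl_of_eq (F.tensor G) (H.tensor K) e2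
          rw [tensor_input_natAdd] at e3
          exact (congrArg _ (congrArg (fun x => toLex (Sum.inr x)) e1)).trans e3.symm
        · have e1 := comp_conn_inl_of_ne G K hv
          have e2 : (F.tensor G).right ((F.tensor G).conn (toLex (Sum.inr v))) ≠ none := h4 ⟨_, hv⟩
          have e3 := comp_conn_inl_of_ne (F.tensor G) (H.tensor K) e2
          exact (congrArg _ (congrArg (fun x => toLex (Sum.inr x)) e1)).trans e3.symm
      · rfl)
    (by
      rintro ((x | x) | (x | x)) <;> rfl)

/-- The tensor product is associative. -/
noncomputable def tensorAssoc (F : TypedHypergraph S m n) (G : TypedHypergraph S p q)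
    (H : TypedHypergraph S r s) :
    WireIso (finCongr (Nat.add_assoc _ _ _)) (finCongr (Nat.add_assoc _ _ _))
      ((F.tensor G).tensor H) (F.tensor (G.tensor H)) :=
  ofMaps (fun v => Sum.elim (fun v => Sum.elim (fun v => toLex (Sum.inl v))
      (fun v => toLex (Sum.inr (toLex (Sum.inl v)))) (ofLex v))
      (fun v => toLex (Sum.inr (toLex (Sum.inr v)))) (ofLex v))
    (fun v => Sum.elim (fun v => Sum.elim (fun v => toLex (Sum.inl v))
      (fun v => toLex (Sum.inr (toLex (Sum.inl v)))) (ofLex v))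
      (fun v => toLex (Sum.inr (toLex (Sum.inr v)))) (ofLex v))
    (Equiv.sumAssoc F.E G.E H.E)
    (by
      refine FibreMap.congr (FibreMap.sumElim (FibreMap.sumElim (FibreMap.inl F.left _)
        ((FibreMap.inr F.left _).comp (FibreMap.inl G.left H.left)))
        ((FibreMap.inr F.left _).comp (FibreMap.inr G.left H.left))) ?_
      rintro ((x | x) | x) <;> rfl)
    (by
      refine FibreMap.congr (FibreMap.sumElim (FibreMap.sumElim (FibreMap.inl F.right _)
        ((FibreMap.inr F.right _).comp (FibreMap.inl G.right H.right)))
        ((FibreMap.inr F.right _).comp (FibreMap.inr G.right H.right))) ?_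
      rintro ((x | x) | x) <;> rfl)
    (fun i => by
      induction i using Fin.addCases with
      | left i =>
        induction i using Fin.addCases with
        | left i =>
          rw [show finCongr (Nat.add_assoc m p r) (Fin.castAdd r (Fin.castAdd p i)) =
            Fin.castAdd (p + r) i from rfl]
          simp only [tensor_input_castAdd]
          rfl
        | right i =>
          rw [show finCongr (Nat.add_assoc m p r) (Fin.castAdd r (Fin.natAdd m i)) =
            Fin.natAdd m (Fin.castAdd r i) from rfl]
          simp only [tensor_input_castAdd, tensor_input_natAdd]
          rfl
      | right i =>
        rw [show finCongr (Nat.add_assoc m p r) (Fin.natAdd (m + p) i) =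
          Fin.natAdd m (Fin.natAdd p i) from Fin.ext (Nat.add_assoc _ _ _)]
        simp only [tensor_input_natAdd]
        rfl)
    (fun i => by
      induction i using Fin.addCases with
      | left i =>
        induction i using Fin.addCases with
        | left i =>
          rw [show finCongr (Nat.add_assoc n q s) (Fin.castAdd s (Fin.castAdd q i)) =
            Fin.castAdd (q + s) i from rfl]
          simp only [tensor_output_castAdd]
          rfl
        | right i =>
          rw [show finCongr (Nat.add_assoc n q s) (Fin.castAdd s (Fin.natAdd n i)) =
            Fin.natAdd n (Fin.castAdd s i) from rfl]
          simp only [tensor_output_castAdd, tensor_output_natAdd]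
          rfl
      | right i =>
        rw [show finCongr (Nat.add_assoc n q s) (Fin.natAdd (n + q) i) =
          Fin.natAdd n (Fin.natAdd q i) from Fin.ext (Nat.add_assoc _ _ _)]
        simp only [tensor_output_natAdd]
        rfl)
    (by
      rintro ((v | v) | v) <;> rfl)
    (by
      rintro ((x | x) | x) <;> rfl)

/-- The tensor product is commutative up to a block transposition of the interfaces. -/
noncomputable def tensorComm (F : TypedHypergraph S m n) (G : TypedHypergraph S p q) :
    WireIso finAddFlip finAddFlip (F.tensor G) (G.tensor F) :=
  ofMaps (fun v => Sum.elim (fun v => toLex (Sum.inr v)) (fun v => toLex (Sum.inl v)) (ofLex v))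
    (fun v => Sum.elim (fun v => toLex (Sum.inr v)) (fun v => toLex (Sum.inl v)) (ofLex v))
    (Equiv.sumComm F.E G.E)
    (by
      refine FibreMap.congr
        (FibreMap.sumElim (FibreMap.inr G.left F.left) (FibreMap.inl G.left F.left)) ?_
      rintro (x | x) <;> rfl)
    (by
      refine FibreMap.congr
        (FibreMap.sumElim (FibreMap.inr G.right F.right) (FibreMap.inl G.right F.right)) ?_
      rintro (x | x) <;> rfl)
    (fun i => by
      induction i using Fin.addCases with
      | left i =>
        rw [finAddFlip_apply_castAdd, tensor_input_castAdd, tensor_input_natAdd]; rfl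
      | right i =>
        rw [finAddFlip_apply_natAdd, tensor_input_castAdd, tensor_input_natAdd]; rfl)
    (fun i => by
      induction i using Fin.addCases with
      | left i =>
        rw [finAddFlip_apply_castAdd, tensor_output_castAdd, tensor_output_natAdd]; rfl
      | right i =>
        rw [finAddFlip_apply_natAdd, tensor_output_castAdd, tensor_output_natAdd]; rfl)
    (by
      rintro (v | v) <;> rfl)
    (by
      rintro (x | x) <;> rfl)

/-- The identity on `0` is a right unit for the tensor product. -/
noncomputable def tensorUnit (F : TypedHypergraph S m n) :
    WireIso (Equiv.refl _) (Equiv.refl _) (F.tensor (identity S 0)) F :=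
  have h1 : IsEmpty (identity S 0).Vt := inferInstanceAs (IsEmpty (Fin 0))
  have h2 : IsEmpty (identity S 0).Vs := inferInstanceAs (IsEmpty (Fin 0))
  ofMaps (fun v => Sum.elim _root_.id h1.elim (ofLex v))
    (fun v => Sum.elim _root_.id h2.elim (ofLex v))
    (Equiv.sumEmpty F.E Empty)
    (by
      refine FibreMap.congr (FibreMap.sumElim (E' := (identity S 0).E) (e' := Empty.elim)
        (l' := (identity S 0).left) (g := h1.elim) (FibreMap.id F.left) FibreMap.of_isEmpty) ?_
      rintro (x | x)
      exacts [rfl, x.elim])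
    (by
      refine FibreMap.congr (FibreMap.sumElim (E' := (identity S 0).E) (e' := Empty.elim)
        (l' := (identity S 0).right) (g := h2.elim) (FibreMap.id F.right) FibreMap.of_isEmpty) ?_
      rintro (x | x)
      exacts [rfl, x.elim])
    (fun i => by
      refine (congrArg _ (tensor_input_castAdd F (identity S 0) i)).trans ?_
      rfl)
    (fun i => by
      refine (congrArg _ (tensor_output_castAdd F (identity S 0) i)).trans ?_
      rfl)
    (by
      rintro (v | v)
      exacts [rfl, h1.elim v])
    (by
      rintro (x | x)
      exacts [rfl, x.elim])

/-- The tensor product of identities is an identity. -/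
noncomputable def tensorId (m n : ℕ) :
    WireIso (Equiv.refl _) (Equiv.refl _) ((identity S m).tensor (identity S n))
      (identity S (m + n)) :=
  ofMaps (fun v => Sum.elim (Fin.castAdd n) (Fin.natAdd m) (ofLex v))
    (fun v => Sum.elim (Fin.castAdd n) (Fin.natAdd m) (ofLex v))
    (Equiv.sumEmpty Empty Empty)
    (FibreMap.of_none (by rintro (v | v) <;> rfl) (fun _ => rfl))
    (FibreMap.of_none (by rintro (v | v) <;> rfl) (fun _ => rfl))
    (fun i => by
      induction i using Fin.addCases with
      | left i =>
        rw [tensor_input_castAdd, identity_input, identity_input]; rfl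
      | right i =>
        rw [tensor_input_natAdd, identity_input, identity_input]; rfl)
    (fun i => by
      induction i using Fin.addCases with
      | left i =>
        rw [tensor_output_castAdd, identity_output, identity_output]; rfl
      | right i =>
        rw [tensor_output_natAdd, identity_output, identity_output]; rfl)
    (by
      rintro (v | v) <;> rfl)
    (by
      rintro (x | x) <;> exact x.elim)

/-- The identity on `0` is the empty hypergraph. -/
noncomputable def identityZero : WireIso (Equiv.refl _) (Equiv.refl _) (identity S 0) (empty S) :=
  ofMaps (fun v => finZeroElim (α := fun _ => (empty S).Vt) v)
    (fun v => finZeroElim (α := fun _ => (empty S).Vs) v)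
    (Equiv.refl Empty)
    (FibreMap.of_none (fun _ => rfl) (fun v => Fin.elim0 v))
    (FibreMap.of_none (fun _ => rfl) (fun v => Fin.elim0 v))
    (fun i => i.elim0) (fun i => i.elim0) (fun v => Fin.elim0 v) (fun x => x.elim)

end WireIso

/-! ### The trace of one wire -/

theorem cast_input (F : TypedHypergraph S m n) (hm : m = m') (hn : n = n') (i : Fin m') :
    (F.cast hm hn).input i = F.input (Fin.cast hm.symm i) := by
  subst hm hn
  rfl

theorem cast_output (F : TypedHypergraph S m n) (hm : m = m') (hn : n = n') (i : Fin n') :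
    (F.cast hm hn).output i = F.output (Fin.cast hn.symm i) := by
  subst hm hn
  rfl

theorem input_natAdd_ne_firstInput (F : TypedHypergraph S (1 + m) (1 + n)) (i : Fin m) :
    F.input (Fin.natAdd 1 i) ≠ F.firstInput := fun h => by
  have := congrArg Fin.val (F.input_strictMono.injective h)
  simp only [Fin.val_natAdd] at this
  omega

theorem output_natAdd_ne_firstOutput (F : TypedHypergraph S (1 + m) (1 + n)) (i : Fin n) :
    F.output (Fin.natAdd 1 i) ≠ F.firstOutput := fun h => by
  have := congrArg Fin.val (F.output_strictMono.injective h)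
  simp only [Fin.val_natAdd] at this
  omega

theorem traceOne_input (F : TypedHypergraph S (1 + m) (1 + n)) (i : Fin m) :
    (traceOne F).input i = (⟨F.input (Fin.natAdd 1 i), F.input_natAdd_ne_firstInput i⟩ :
      {v : F.Vt // v ≠ F.firstInput}) :=
  input_eq (traceOne F)
    (f := fun i => (⟨F.input (Fin.natAdd 1 i), F.input_natAdd_ne_firstInput i⟩ :
      {v : F.Vt // v ≠ F.firstInput}))
    (fun _ _ h => F.input_strictMono ((Fin.strictMono_natAdd 1) h)) (fun _ => F.left_input _) i

theorem traceOne_output (F : TypedHypergraph S (1 + m) (1 + n)) (i : Fin n) :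
    (traceOne F).output i = (⟨F.output (Fin.natAdd 1 i), F.output_natAdd_ne_firstOutput i⟩ :
      {v : F.Vs // v ≠ F.firstOutput}) :=
  output_eq (traceOne F)
    (f := fun i => (⟨F.output (Fin.natAdd 1 i), F.output_natAdd_ne_firstOutput i⟩ :
      {v : F.Vs // v ≠ F.firstOutput}))
    (fun _ _ h => F.output_strictMono ((Fin.strictMono_natAdd 1) h)) (fun _ => F.right_output _) i

/-- The connections of a trace as a map between the vertices of the traced hypergraph. -/
noncomputable def traceStep (F : TypedHypergraph S (1 + m) (1 + n)) (v : F.Vt) : F.Vs :=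
  if F.conn v = F.firstOutput then F.conn F.firstInput else F.conn v

theorem traceStep_of_eq (F : TypedHypergraph S (1 + m) (1 + n)) {v : F.Vt}
    (h : F.conn v = F.firstOutput) : F.traceStep v = F.conn F.firstInput := if_pos h

theorem traceStep_of_ne (F : TypedHypergraph S (1 + m) (1 + n)) {v : F.Vt}
    (h : F.conn v ≠ F.firstOutput) : F.traceStep v = F.conn v := if_neg h

/-- `traceStep` is defined on all vertices of `F`, so the connections of a trace can be computed
without carrying proofs that vertices survive. -/
theorem traceOne_conn (F : TypedHypergraph S (1 + m) (1 + n)) (v : {v : F.Vt // v ≠ F.firstInput}) :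
    ((traceOne F).conn v : {v : F.Vs // v ≠ F.firstOutput}).1 = F.traceStep v.1 := by
  by_cases h : F.conn v.1 = F.firstOutput
  · rw [traceStep_of_eq F h]
    exact congrArg Subtype.val (dif_pos h)
  · rw [traceStep_of_ne F h]
    exact congrArg Subtype.val (dif_neg h)

theorem traceStep_ne (F : TypedHypergraph S (1 + m) (1 + n)) {v : F.Vt}
    (hv : v ≠ F.firstInput) : F.traceStep v ≠ F.firstOutput := by
  rw [← traceOne_conn F ⟨v, hv⟩]
  exact ((traceOne F).conn ⟨v, hv⟩ : {v : F.Vs // v ≠ F.firstOutput}).2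

namespace WireIso

/-- The trace of one wire respects isomorphism. -/
noncomputable def traceOne {π : Fin (1 + m) ≃ Fin (1 + m')} {ρ : Fin (1 + n) ≃ Fin (1 + n')}
    {F : TypedHypergraph S (1 + m) (1 + n)} {G : TypedHypergraph S (1 + m') (1 + n')}
    (h : WireIso π ρ F G) (π' : Fin m ≃ Fin m') (ρ' : Fin n ≃ Fin n')
    (hπ : π (Fin.castAdd m 0) = Fin.castAdd m' 0) (hρ : ρ (Fin.castAdd n 0) = Fin.castAdd n' 0)
    (hπ' : ∀ i, π (Fin.natAdd 1 i) = Fin.natAdd 1 (π' i))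
    (hρ' : ∀ i, ρ (Fin.natAdd 1 i) = Fin.natAdd 1 (ρ' i)) :
    WireIso π' ρ' (traceOne F) (traceOne G) :=
  have hi : h.vt F.firstInput = G.firstInput := (h.input _).trans (congrArg _ hπ)
  have ho : h.vs F.firstOutput = G.firstOutput := (h.output _).trans (congrArg _ hρ)
  have h1 : ∀ v : {v : F.Vt // v ≠ F.firstInput}, h.vt v.1 ≠ G.firstInput := fun v => by
    rw [← hi]; exact h.vt.injective.ne v.2
  have h2 : ∀ v : {v : F.Vs // v ≠ F.firstOutput}, h.vs v.1 ≠ G.firstOutput := fun v => by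
    rw [← ho]; exact h.vs.injective.ne v.2
  ofMaps (F := TypedHypergraph.traceOne F) (G := TypedHypergraph.traceOne G)
    (fun v => ⟨h.vt v.1, h1 v⟩) (fun v => ⟨h.vs v.1, h2 v⟩) h.e
    ((h.left.comp (FibreMap.val _ _)).codRestrict _ h1)
    ((h.right.comp (FibreMap.val _ _)).codRestrict _ h2)
    (fun i => by
      rw [traceOne_input, traceOne_input]
      exact Subtype.ext ((h.input _).trans (congrArg _ (hπ' i))))
    (fun i => by
      rw [traceOne_output, traceOne_output]
      exact Subtype.ext ((h.output _).trans (congrArg _ (hρ' i))))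
    (fun v => by
      apply Subtype.ext
      rw [traceOne_conn]
      refine (congrArg h.vs (traceOne_conn F v)).trans ?_
      by_cases hv : F.conn v.1 = F.firstOutput
      · rw [traceStep_of_eq F hv, traceStep_of_eq G, h.conn, hi]
        rw [← h.conn, hv, ho]
      · rw [traceStep_of_ne F hv, traceStep_of_ne G, h.conn]
        rw [← h.conn, ← ho]
        exact h.vs.injective.ne hv)
    h.label

/-- Superposing for the trace of one wire. -/
noncomputable def superposingOne (F : TypedHypergraph S (1 + m) (1 + n))
    (G : TypedHypergraph S p q) :
    WireIso (Equiv.refl _) (Equiv.refl _) ((TypedHypergraph.traceOne F).tensor G)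
      (TypedHypergraph.traceOne ((F.tensor G).cast (Nat.add_assoc _ _ _) (Nat.add_assoc _ _ _))) :=
  -- The deleted first wire of the tensor product lies in the left factor, so closing it does not
  -- affect `G`.
  have hi : ((F.tensor G).cast (Nat.add_assoc _ _ _) (Nat.add_assoc _ _ _)).firstInput =
      toLex (Sum.inl F.firstInput) :=
    (cast_input _ _ _ _).trans (tensor_input_castAdd F G (Fin.castAdd m 0))
  have ho : ((F.tensor G).cast (Nat.add_assoc _ _ _) (Nat.add_assoc _ _ _)).firstOutput =
      toLex (Sum.inl F.firstOutput) :=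
    (cast_output _ _ _ _).trans (tensor_output_castAdd F G (Fin.castAdd n 0))
  have h1 : ∀ v : {v : F.Vt // v ≠ F.firstInput}, toLex (Sum.inl v.1) ≠
      ((F.tensor G).cast (Nat.add_assoc _ _ _) (Nat.add_assoc _ _ _)).firstInput := fun v h => by
    rw [hi] at h; exact v.2 (Sum.inl_injective h)
  have h2 : ∀ v : G.Vt, toLex (Sum.inr v) ≠
      ((F.tensor G).cast (Nat.add_assoc _ _ _) (Nat.add_assoc _ _ _)).firstInput := fun v h => by
    rw [hi] at h; exact Sum.inr_ne_inl h
  have h3 : ∀ v : {v : F.Vs // v ≠ F.firstOutput}, toLex (Sum.inl v.1) ≠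
      ((F.tensor G).cast (Nat.add_assoc _ _ _) (Nat.add_assoc _ _ _)).firstOutput := fun v h => by
    rw [ho] at h; exact v.2 (Sum.inl_injective h)
  have h4 : ∀ v : G.Vs, toLex (Sum.inr v) ≠
      ((F.tensor G).cast (Nat.add_assoc _ _ _) (Nat.add_assoc _ _ _)).firstOutput := fun v h => by
    rw [ho] at h; exact Sum.inr_ne_inl h
  ofMaps
    (fun v => Sum.elim
      (fun v : {v : F.Vt // v ≠ F.firstInput} => ⟨toLex (Sum.inl v.1), h1 v⟩)
      (fun v => ⟨toLex (Sum.inr v), h2 v⟩) (ofLex v))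
    (fun v => Sum.elim
      (fun v : {v : F.Vs // v ≠ F.firstOutput} => ⟨toLex (Sum.inl v.1), h3 v⟩)
      (fun v => ⟨toLex (Sum.inr v), h4 v⟩) (ofLex v))
    (Equiv.refl _)
    (by
      refine FibreMap.congr (FibreMap.sumElim
        (((FibreMap.inl F.left G.left).comp (FibreMap.val _ _)).codRestrict _ h1)
        ((FibreMap.inr F.left G.left).codRestrict _ h2)) ?_
      rintro (x | x) <;> rfl)
    (by
      refine FibreMap.congr (FibreMap.sumElim
        (((FibreMap.inl F.right G.right).comp (FibreMap.val _ _)).codRestrict _ h3)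
        ((FibreMap.inr F.right G.right).codRestrict _ h4)) ?_
      rintro (x | x) <;> rfl)
    (fun i => by
      rw [Equiv.refl_apply, traceOne_input]
      apply Subtype.ext
      refine Eq.trans ?_ (cast_input (F.tensor G) (Nat.add_assoc 1 m p) (Nat.add_assoc 1 n q)
        (Fin.natAdd 1 i)).symm
      induction i using Fin.addCases with
      | left i =>
        rw [tensor_input_castAdd, traceOne_input]
        exact (tensor_input_castAdd F G (Fin.natAdd 1 i)).symm
      | right i =>
        rw [tensor_input_natAdd]
        refine (tensor_input_natAdd F G i).symm.trans (congrArg _ (Fin.ext ?_))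
        simp [Nat.add_assoc])
    (fun i => by
      rw [Equiv.refl_apply, traceOne_output]
      apply Subtype.ext
      refine Eq.trans ?_ (cast_output (F.tensor G) (Nat.add_assoc 1 m p) (Nat.add_assoc 1 n q)
        (Fin.natAdd 1 i)).symm
      induction i using Fin.addCases with
      | left i =>
        rw [tensor_output_castAdd, traceOne_output]
        exact (tensor_output_castAdd F G (Fin.natAdd 1 i)).symm
      | right i =>
        rw [tensor_output_natAdd]
        refine (tensor_output_natAdd F G i).symm.trans (congrArg _ (Fin.ext ?_))
        simp [Nat.add_assoc])
    (by
      rintro (v | v)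
      · apply Subtype.ext
        refine Eq.trans ?_ (traceOne_conn _ _).symm
        refine (congrArg (fun x => toLex (Sum.inl x)) (traceOne_conn F v)).trans ?_
        by_cases hv : F.conn v.1 = F.firstOutput
        · rw [traceStep_of_eq F hv, traceStep_of_eq, hi]
          · rfl
          · rw [ho, ← hv]; rfl
        · rw [traceStep_of_ne F hv, traceStep_of_ne]
          · rfl
          · exact h3 ⟨_, hv⟩
      · apply Subtype.ext
        refine Eq.trans ?_ (traceOne_conn _ _).symm
        exact (traceStep_of_ne ((F.tensor G).cast (Nat.add_assoc 1 m p) (Nat.add_assoc 1 n q))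
          (v := toLex (Sum.inr v)) (h4 (G.conn v))).symm)
    (by
      rintro (x | x) <;> rfl)

/-- Left tightening for the trace of one wire. -/
noncomputable def tighteningLeftOne (G : TypedHypergraph S p m)
    (F : TypedHypergraph S (1 + m) (1 + n)) :
    WireIso (Equiv.refl _) (Equiv.refl _) (G.comp (TypedHypergraph.traceOne F))
      (TypedHypergraph.traceOne (((identity S 1).tensor G).comp F)) :=
  have hi : (((identity S 1).tensor G).comp F).firstInput =
      toLex (Sum.inl (((identity S 1).tensor G).input (Fin.castAdd p 0))) := comp_input _ _ _
  have hi' : ((identity S 1).tensor G).input (Fin.castAdd p 0) =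
      toLex (Sum.inl ((identity S 1).input 0)) := tensor_input_castAdd _ _ _
  have ho : (((identity S 1).tensor G).comp F).firstOutput = toLex (Sum.inr F.firstOutput) :=
    comp_output _ _ _
  have h1 : ∀ v : G.Vt, toLex (Sum.inl (toLex (Sum.inr v))) ≠
      (((identity S 1).tensor G).comp F).firstInput := fun v h => by
    rw [hi] at h; exact Sum.inr_ne_inl ((Sum.inl_injective h).trans hi')
  have h1' : ∀ v : {v : {v : F.Vt // v ≠ F.firstInput} // F.left v.1 ≠ none},
      F.left v.1.1 ≠ none := fun v => v.2
  have h2 : ∀ v : {v : F.Vt // F.left v ≠ none}, toLex (Sum.inr v) ≠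
      (((identity S 1).tensor G).comp F).firstInput := fun v h => by
    rw [hi] at h; exact Sum.inr_ne_inl h
  have h3' : ∀ v : {v : G.Vs // G.right v ≠ none},
      ((identity S 1).tensor G).right (toLex (Sum.inr v.1)) ≠ none :=
    fun v h => v.2 (Option.map_eq_none_iff.1 h)
  have h3 : ∀ v : {v : ((identity S 1).tensor G).Vs // ((identity S 1).tensor G).right v ≠ none},
      toLex (Sum.inl v) ≠ (((identity S 1).tensor G).comp F).firstOutput := fun v h => by
    rw [ho] at h; exact Sum.inl_ne_inr h
  have h4 : ∀ v : {v : F.Vs // v ≠ F.firstOutput}, toLex (Sum.inr v.1) ≠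
      (((identity S 1).tensor G).comp F).firstOutput := fun v h => by
    rw [ho] at h; exact v.2 (Sum.inr_injective h)
  -- Once a connection has entered `F` at `v`, feedback acts alike on both sides: in the composite
  -- the first input is a vertex of the identity wire, whose output is glued to the first input of
  -- `F`. This serves both the wires arriving from `G` and those starting inside `F`.
  have key : ∀ (v : F.Vt) (w : (((identity S 1).tensor G).comp F).Vt),
      (((identity S 1).tensor G).comp F).conn w = toLex (Sum.inr (F.conn v)) →
      toLex (Sum.inr (F.traceStep v)) = (((identity S 1).tensor G).comp F).traceStep w :=
    fun v w h => by
      by_cases hv : F.conn v = F.firstOutput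
      · rw [traceStep_of_eq F hv, traceStep_of_eq, hi]
        · refine (comp_conn_inl_of_eq (i := Fin.castAdd m 0) _ F ?_).symm
          rw [tensor_output_castAdd, hi', ← identity_conn_input]
          rfl
        · rw [h, hv, ho]
      · rw [traceStep_of_ne F hv, traceStep_of_ne, h]
        rw [h]
        exact h4 ⟨_, hv⟩
  ofMaps
    (fun v => Sum.elim (fun v => ⟨toLex (Sum.inl (toLex (Sum.inr v))), h1 v⟩)
      (fun v => ⟨toLex (Sum.inr ⟨v.1.1, h1' v⟩), h2 _⟩) (ofLex v))
    (fun v => Sum.elim (fun v => ⟨toLex (Sum.inl ⟨toLex (Sum.inr v.1), h3' v⟩), h3 _⟩)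
      (fun v : {v : F.Vs // v ≠ F.firstOutput} => ⟨toLex (Sum.inr v.1), h4 v⟩) (ofLex v))
    (Equiv.sumCongr (Equiv.emptySum Empty G.E).symm (Equiv.refl F.E))
    (by
      refine FibreMap.congr (FibreMap.sumElim
        (((FibreMap.inl ((identity S 1).tensor G).left _).comp
          (FibreMap.inr (identity S 1).left G.left)).codRestrict
            (fun v => v ≠ (((identity S 1).tensor G).comp F).firstInput) h1)
        (((FibreMap.inr ((identity S 1).tensor G).left
          (fun v : {v : F.Vt // F.left v ≠ none} => F.left v.1)).comp
          (((FibreMap.val F.left (fun v => v ≠ F.firstInput)).comp (FibreMap.val _ _)).codRestrict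
            (fun v => F.left v ≠ none) h1')).codRestrict
            (fun v => v ≠ (((identity S 1).tensor G).comp F).firstInput) (fun _ => h2 _))) ?_
      rintro (x | x) <;> rfl)
    (by
      refine FibreMap.congr (FibreMap.sumElim
        (((FibreMap.inl (fun v : {v // ((identity S 1).tensor G).right v ≠ none} =>
          ((identity S 1).tensor G).right v.1) F.right).comp
          (((FibreMap.inr (identity S 1).right G.right).comp (FibreMap.val _ _)).codRestrict
            (fun v => ((identity S 1).tensor G).right v ≠ none) h3')).codRestrict
            (fun v => v ≠ (((identity S 1).tensor G).comp F).firstOutput) (fun _ => h3 _))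
        (((FibreMap.inr (fun v : {v // ((identity S 1).tensor G).right v ≠ none} =>
          ((identity S 1).tensor G).right v.1) F.right).comp (FibreMap.val _ _)).codRestrict
            (fun v => v ≠ (((identity S 1).tensor G).comp F).firstOutput) h4)) ?_
      rintro (x | x) <;> rfl)
    (fun i => by
      rw [Equiv.refl_apply, traceOne_input, comp_input]
      apply Subtype.ext
      refine ((comp_input _ _ _).trans ?_).symm
      rw [tensor_input_natAdd]
      rfl)
    (fun i => by
      rw [Equiv.refl_apply, traceOne_output, comp_output, traceOne_output]
      apply Subtype.ext
      exact (comp_output _ _ _).symm)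
    (by
      rintro (v | v)
      · by_cases hv : G.right (G.conn v) = none
        · obtain ⟨i, hi⟩ := G.exists_output hv
          refine (congrArg _ (comp_conn_inl_of_eq G (TypedHypergraph.traceOne F) hi.symm)).trans ?_
          apply Subtype.ext
          refine Eq.trans ?_ (traceOne_conn _ _).symm
          refine Eq.trans ?_ (key (F.input (Fin.natAdd 1 i)) _ ?_)
          · refine congrArg (fun x => toLex (Sum.inr x)) ?_
            rw [traceOne_input]
            exact traceOne_conn F _
          · refine comp_conn_inl_of_eq _ F ?_
            rw [tensor_output_natAdd, hi]
            rfl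
        · refine (congrArg _ (comp_conn_inl_of_ne G (TypedHypergraph.traceOne F) hv)).trans ?_
          apply Subtype.ext
          refine Eq.trans ?_ (traceOne_conn _ _).symm
          have e1 := comp_conn_inl_of_ne ((identity S 1).tensor G) F
            (v := toLex (Sum.inr v)) (h3' ⟨_, hv⟩)
          refine (e1.symm.trans (traceStep_of_ne _ ?_).symm)
          exact fun h => h3 _ (e1.symm.trans h)
      · apply Subtype.ext
        refine Eq.trans ?_ (traceOne_conn _ _).symm
        refine Eq.trans ?_ (key v.1.1 _ rfl)
        exact congrArg (fun x => toLex (Sum.inr x)) (traceOne_conn F v.1))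
    (by
      rintro (x | x) <;> rfl)

/-- Right tightening for the trace of one wire. -/
noncomputable def tighteningRightOne (F : TypedHypergraph S (1 + m) (1 + n))
    (H : TypedHypergraph S n q) :
    WireIso (Equiv.refl _) (Equiv.refl _) ((TypedHypergraph.traceOne F).comp H)
      (TypedHypergraph.traceOne (F.comp ((identity S 1).tensor H))) :=
  have hi : (F.comp ((identity S 1).tensor H)).firstInput = toLex (Sum.inl F.firstInput) :=
    comp_input _ _ _
  have ho : (F.comp ((identity S 1).tensor H)).firstOutput =
      toLex (Sum.inr (((identity S 1).tensor H).output (Fin.castAdd q 0))) := comp_output _ _ _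
  have ho' : ((identity S 1).tensor H).output (Fin.castAdd q 0) =
      toLex (Sum.inl ((identity S 1).output 0)) := tensor_output_castAdd _ _ _
  have h1 : ∀ v : {v : F.Vt // v ≠ F.firstInput}, toLex (Sum.inl v.1) ≠
      (F.comp ((identity S 1).tensor H)).firstInput := fun v h => by
    rw [hi] at h; exact v.2 (Sum.inl_injective h)
  have h2' : ∀ v : {v : H.Vt // H.left v ≠ none},
      ((identity S 1).tensor H).left (toLex (Sum.inr v.1)) ≠ none :=
    fun v h => v.2 (Option.map_eq_none_iff.1 h)
  have h2 : ∀ v : {v : ((identity S 1).tensor H).Vt // ((identity S 1).tensor H).left v ≠ none},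
      toLex (Sum.inr v) ≠ (F.comp ((identity S 1).tensor H)).firstInput := fun v h => by
    rw [hi] at h; exact Sum.inr_ne_inl h
  have h3' : ∀ v : {v : {v : F.Vs // v ≠ F.firstOutput} // F.right v.1 ≠ none},
      F.right v.1.1 ≠ none := fun v => v.2
  have h3 : ∀ v : {v : F.Vs // F.right v ≠ none}, toLex (Sum.inl v) ≠
      (F.comp ((identity S 1).tensor H)).firstOutput := fun v h => by
    rw [ho] at h; exact Sum.inl_ne_inr h
  have h4 : ∀ v : H.Vs, toLex (Sum.inr (toLex (Sum.inr v))) ≠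
      (F.comp ((identity S 1).tensor H)).firstOutput := fun v h => by
    rw [ho] at h; exact Sum.inr_ne_inl ((Sum.inr_injective h).trans ho')
  have hfirst : ∀ v : F.Vt, F.conn v = F.firstOutput →
      (F.comp ((identity S 1).tensor H)).conn (toLex (Sum.inl v)) =
        (F.comp ((identity S 1).tensor H)).firstOutput := fun v h => by
    refine (comp_conn_inl_of_eq (i := Fin.castAdd n 0) F ((identity S 1).tensor H) h).trans ?_
    rw [ho, ho', tensor_input_castAdd, ← identity_conn_input]
    rfl
  have hne : ∀ (v : F.Vt) (h : F.right (F.conn v) ≠ none),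
      (F.comp ((identity S 1).tensor H)).conn (toLex (Sum.inl v)) =
        toLex (Sum.inl ⟨F.conn v, h⟩) := fun v h => comp_conn_inl_of_ne F _ h
  have heq : ∀ (v : F.Vt) (j : Fin n), F.conn v = F.output (Fin.natAdd 1 j) →
      (F.comp ((identity S 1).tensor H)).conn (toLex (Sum.inl v)) =
        toLex (Sum.inr (toLex (Sum.inr (H.conn (H.input j))))) := fun v j h => by
    refine (comp_conn_inl_of_eq F ((identity S 1).tensor H) h).trans ?_
    rw [tensor_input_natAdd]
    rfl
  have hcases : ∀ w : F.Vs, w ≠ F.firstOutput → F.right w = none →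
      ∃ j, w = F.output (Fin.natAdd 1 j) := fun w h h' => by
    obtain ⟨i, rfl⟩ := F.exists_output h'
    induction i using Fin.addCases with
    | left i => rw [Subsingleton.elim i 0] at h; exact absurd rfl h
    | right j => exact ⟨j, rfl⟩
  -- Tracing means taking the connection of another vertex `u`: the first input if `v` runs into the
  -- first output, and `v` itself otherwise. The same `u` works before and after composing with `H`,
  -- which separates the feedback from the gluing.
  have hstep : ∀ v : {v : F.Vt // v ≠ F.firstInput}, ∃ u : F.Vt, F.traceStep v.1 = F.conn u ∧
      (F.comp ((identity S 1).tensor H)).traceStep (toLex (Sum.inl v.1)) =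
        (F.comp ((identity S 1).tensor H)).conn (toLex (Sum.inl u)) := fun v => by
    by_cases hv : F.conn v.1 = F.firstOutput
    · refine ⟨F.firstInput, traceStep_of_eq F hv, ?_⟩
      rw [traceStep_of_eq _ (hfirst _ hv), hi]
      rfl
    · refine ⟨v.1, traceStep_of_ne F hv, traceStep_of_ne _ ?_⟩
      by_cases hr : F.right (F.conn v.1) = none
      · obtain ⟨j, hj⟩ := hcases _ hv hr
        rw [heq _ j hj]
        exact h4 _
      · rw [hne _ hr]
        exact h3 _
  ofMaps
    (fun v => Sum.elim
      (fun v : {v : F.Vt // v ≠ F.firstInput} => ⟨toLex (Sum.inl v.1), h1 v⟩)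
      (fun v => ⟨toLex (Sum.inr ⟨toLex (Sum.inr v.1), h2' v⟩), h2 _⟩) (ofLex v))
    (fun v => Sum.elim (fun v => ⟨toLex (Sum.inl ⟨v.1.1, h3' v⟩), h3 _⟩)
      (fun v => ⟨toLex (Sum.inr (toLex (Sum.inr v))), h4 v⟩) (ofLex v))
    (Equiv.sumCongr (Equiv.refl F.E) (Equiv.emptySum Empty H.E).symm)
    (by
      refine FibreMap.congr (FibreMap.sumElim
        (((FibreMap.inl F.left (fun v : {v // ((identity S 1).tensor H).left v ≠ none} =>
          ((identity S 1).tensor H).left v.1)).comp (FibreMap.val _ _)).codRestrict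
            (fun v => v ≠ (F.comp ((identity S 1).tensor H)).firstInput) h1)
        (((FibreMap.inr F.left (fun v : {v // ((identity S 1).tensor H).left v ≠ none} =>
          ((identity S 1).tensor H).left v.1)).comp
          (((FibreMap.inr (identity S 1).left H.left).comp (FibreMap.val _ _)).codRestrict
            (fun v => ((identity S 1).tensor H).left v ≠ none) h2')).codRestrict
            (fun v => v ≠ (F.comp ((identity S 1).tensor H)).firstInput) (fun _ => h2 _))) ?_
      rintro (x | x) <;> rfl)
    (by
      refine FibreMap.congr (FibreMap.sumElim
        (((FibreMap.inl (fun v : {v : F.Vs // F.right v ≠ none} => F.right v.1)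
          ((identity S 1).tensor H).right).comp
          (((FibreMap.val F.right (fun v => v ≠ F.firstOutput)).comp
            (FibreMap.val _ _)).codRestrict (fun v => F.right v ≠ none) h3')).codRestrict
            (fun v => v ≠ (F.comp ((identity S 1).tensor H)).firstOutput) (fun _ => h3 _))
        (((FibreMap.inr (fun v : {v : F.Vs // F.right v ≠ none} => F.right v.1)
          ((identity S 1).tensor H).right).comp
          (FibreMap.inr (identity S 1).right H.right)).codRestrict
            (fun v => v ≠ (F.comp ((identity S 1).tensor H)).firstOutput) h4)) ?_
      rintro (x | x) <;> rfl)
    (fun i => by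
      rw [Equiv.refl_apply, traceOne_input, comp_input, traceOne_input]
      apply Subtype.ext
      exact (comp_input _ _ _).symm)
    (fun i => by
      rw [Equiv.refl_apply, traceOne_output, comp_output]
      apply Subtype.ext
      refine ((comp_output _ _ _).trans ?_).symm
      rw [tensor_output_natAdd]
      rfl)
    (by
      rintro (v | v)
      · obtain ⟨u, hu, hu'⟩ := hstep v
        have hc : ((TypedHypergraph.traceOne F).conn v : {v : F.Vs // v ≠ F.firstOutput}).1 =
          F.conn u := (traceOne_conn F v).trans hu
        by_cases hv : (TypedHypergraph.traceOne F).right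
            ((TypedHypergraph.traceOne F).conn v) = none
        · obtain ⟨j, hj⟩ := (TypedHypergraph.traceOne F).exists_output hv
          refine (congrArg _ (comp_conn_inl_of_eq (TypedHypergraph.traceOne F) H hj.symm)).trans ?_
          apply Subtype.ext
          refine Eq.trans ?_ (traceOne_conn _ _).symm
          refine Eq.trans ?_ hu'.symm
          refine (heq u j ?_).symm
          rw [← hc, ← hj, traceOne_output]
        · refine (congrArg _ (comp_conn_inl_of_ne (TypedHypergraph.traceOne F) H hv)).trans ?_
          apply Subtype.ext
          refine Eq.trans ?_ (traceOne_conn _ _).symm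
          refine Eq.trans ?_ hu'.symm
          have hr : F.right (F.conn u) ≠ none := hc ▸ hv
          refine Eq.trans ?_ (hne u hr).symm
          exact congrArg (fun x => toLex (Sum.inl x)) (Subtype.ext hc)
      · apply Subtype.ext
        refine Eq.trans ?_ (traceOne_conn _ _).symm
        exact (traceStep_of_ne (F.comp ((identity S 1).tensor H))
          (v := toLex (Sum.inr ⟨toLex (Sum.inr v.1), h2' v⟩)) (h4 (H.conn v.1))).symm)
    (by
      rintro (x | x) <;> rfl)

end WireIso

end TypedHypergraph

/-- Both sides follow `c` from `v`, jumping from `b` to `a` and from `b'` to `a'`, until a point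
other than `b` and `b'` is reached. Because `c` is injective and `v` is neither `a` nor `a'`, each
jump occurs at most once, and the order in which the two loops are closed is irrelevant. -/
theorem eq_of_step_eq_step {V W : Type} [DecidableEq W] {c : V → W} (hc : Function.Injective c)
    {a a' v : V} {b b' : W} (ha : a ≠ a') (hb : b ≠ b') (h : v ≠ a) (h' : v ≠ a') :
    (if (if c v = b then c a else c v) = b' then (if c a' = b then c a else c a')
      else (if c v = b then c a else c v)) =
    (if (if c v = b' then c a' else c v) = b then (if c a = b' then c a' else c a)
      else (if c v = b' then c a' else c v)) := by
  have h1 := hc.ne ha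
  have h2 := hc.ne h
  have h3 := hc.ne h'
  grind

namespace TypedHypergraph

variable {S : HypSignature.{u}} {m n p q r s m' n' p' q' : ℕ}

/-! ### Exchanging two traced wires -/

theorem firstInput_traceOne (F : TypedHypergraph S (1 + (1 + m)) (1 + (1 + n))) :
    ((traceOne F).firstInput : {v : F.Vt // v ≠ F.firstInput}).1 =
      F.input (Fin.natAdd 1 (Fin.castAdd m 0)) :=
  congrArg Subtype.val (traceOne_input F (Fin.castAdd m 0))

theorem firstOutput_traceOne (F : TypedHypergraph S (1 + (1 + m)) (1 + (1 + n))) :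
    ((traceOne F).firstOutput : {v : F.Vs // v ≠ F.firstOutput}).1 =
      F.output (Fin.natAdd 1 (Fin.castAdd n 0)) :=
  congrArg Subtype.val (traceOne_output F (Fin.castAdd n 0))

theorem traceOne_traceOne_input (F : TypedHypergraph S (1 + (1 + m)) (1 + (1 + n)))
    (i : Fin m) :
    (((traceOne (traceOne F)).input i :
      {v : (traceOne F).Vt // v ≠ (traceOne F).firstInput}).1 :
        {v : F.Vt // v ≠ F.firstInput}).1 = F.input (Fin.natAdd 1 (Fin.natAdd 1 i)) :=
  (congrArg (fun x : {v : (traceOne F).Vt // v ≠ (traceOne F).firstInput} =>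
    (x.1 : {v : F.Vt // v ≠ F.firstInput}).1) (traceOne_input (traceOne F) i)).trans
    (congrArg Subtype.val (traceOne_input F _))

theorem traceOne_traceOne_output (F : TypedHypergraph S (1 + (1 + m)) (1 + (1 + n)))
    (i : Fin n) :
    (((traceOne (traceOne F)).output i :
      {v : (traceOne F).Vs // v ≠ (traceOne F).firstOutput}).1 :
        {v : F.Vs // v ≠ F.firstOutput}).1 = F.output (Fin.natAdd 1 (Fin.natAdd 1 i)) :=
  (congrArg (fun x : {v : (traceOne F).Vs // v ≠ (traceOne F).firstOutput} =>
    (x.1 : {v : F.Vs // v ≠ F.firstOutput}).1) (traceOne_output (traceOne F) i)).trans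
    (congrArg Subtype.val (traceOne_output F _))

/-- Pulls the second trace back to vertices of `F`, which gives the nested conditionals of
`eq_of_step_eq_step`. -/
theorem traceOne_traceStep (F : TypedHypergraph S (1 + (1 + m)) (1 + (1 + n)))
    (v : {v : F.Vt // v ≠ F.firstInput}) :
    ((traceOne F).traceStep v : {v : F.Vs // v ≠ F.firstOutput}).1 =
      if F.traceStep v.1 = F.output (Fin.natAdd 1 (Fin.castAdd n 0))
      then F.traceStep (F.input (Fin.natAdd 1 (Fin.castAdd m 0))) else F.traceStep v.1 := by
  rw [← firstOutput_traceOne, ← firstInput_traceOne, ← traceOne_conn]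
  by_cases h : (traceOne F).conn v = (traceOne F).firstOutput
  · rw [if_pos (congrArg Subtype.val h), traceStep_of_eq _ h]
    exact traceOne_conn F _
  · rw [if_neg (fun h' => h (Subtype.ext h')), traceStep_of_ne _ h]

namespace WireIso

/-- Exchanging two traced wires. -/
noncomputable def traceOneTraceOne {π : Fin (1 + (1 + m)) ≃ Fin (1 + (1 + m))}
    {ρ : Fin (1 + (1 + n)) ≃ Fin (1 + (1 + n))}
    {F G : TypedHypergraph S (1 + (1 + m)) (1 + (1 + n))} (h : WireIso π ρ F G)
    (hπ0 : π (Fin.castAdd _ 0) = Fin.natAdd 1 (Fin.castAdd m 0))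
    (hπ1 : π (Fin.natAdd 1 (Fin.castAdd m 0)) = Fin.castAdd _ 0)
    (hπ2 : ∀ i, π (Fin.natAdd 1 (Fin.natAdd 1 i)) = Fin.natAdd 1 (Fin.natAdd 1 i))
    (hρ0 : ρ (Fin.castAdd _ 0) = Fin.natAdd 1 (Fin.castAdd n 0))
    (hρ1 : ρ (Fin.natAdd 1 (Fin.castAdd n 0)) = Fin.castAdd _ 0)
    (hρ2 : ∀ i, ρ (Fin.natAdd 1 (Fin.natAdd 1 i)) = Fin.natAdd 1 (Fin.natAdd 1 i)) :
    WireIso (Equiv.refl _) (Equiv.refl _) (TypedHypergraph.traceOne (TypedHypergraph.traceOne F))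
      (TypedHypergraph.traceOne (TypedHypergraph.traceOne G)) :=
  have hi0 : h.vt F.firstInput = G.input (Fin.natAdd 1 (Fin.castAdd m 0)) :=
    (h.input _).trans (congrArg _ hπ0)
  have hi1 : h.vt (F.input (Fin.natAdd 1 (Fin.castAdd m 0))) = G.firstInput :=
    (h.input _).trans (congrArg _ hπ1)
  have ho0 : h.vs F.firstOutput = G.output (Fin.natAdd 1 (Fin.castAdd n 0)) :=
    (h.output _).trans (congrArg _ hρ0)
  have ho1 : h.vs (F.output (Fin.natAdd 1 (Fin.castAdd n 0))) = G.firstOutput :=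
    (h.output _).trans (congrArg _ hρ1)
  have h1 : ∀ v : {v : {v : F.Vt // v ≠ F.firstInput} //
      v ≠ (TypedHypergraph.traceOne F).firstInput}, h.vt v.1.1 ≠ G.firstInput := fun v => by
    rw [← hi1]
    refine h.vt.injective.ne fun h' => v.2 (Subtype.ext ?_)
    rw [h', ← firstInput_traceOne]
  have h1' : ∀ v : {v : {v : F.Vt // v ≠ F.firstInput} //
      v ≠ (TypedHypergraph.traceOne F).firstInput},
      (⟨h.vt v.1.1, h1 v⟩ : {v : G.Vt // v ≠ G.firstInput}) ≠
        (TypedHypergraph.traceOne G).firstInput := fun v h' => by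
    have := (congrArg Subtype.val h').trans (firstInput_traceOne G)
    rw [← hi0] at this
    exact v.1.2 (h.vt.injective this)
  have h2 : ∀ v : {v : {v : F.Vs // v ≠ F.firstOutput} //
      v ≠ (TypedHypergraph.traceOne F).firstOutput}, h.vs v.1.1 ≠ G.firstOutput := fun v => by
    rw [← ho1]
    refine h.vs.injective.ne fun h' => v.2 (Subtype.ext ?_)
    rw [h', ← firstOutput_traceOne]
  have h2' : ∀ v : {v : {v : F.Vs // v ≠ F.firstOutput} //
      v ≠ (TypedHypergraph.traceOne F).firstOutput},
      (⟨h.vs v.1.1, h2 v⟩ : {v : G.Vs // v ≠ G.firstOutput}) ≠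
        (TypedHypergraph.traceOne G).firstOutput := fun v h' => by
    have := (congrArg Subtype.val h').trans (firstOutput_traceOne G)
    rw [← ho0] at this
    exact v.1.2 (h.vs.injective this)
  -- Closing the first wire of `G` corresponds under `h` to closing the second wire of `F`.
  have hstep : ∀ x, G.traceStep (h.vt x) = h.vs
      (if F.conn x = F.output (Fin.natAdd 1 (Fin.castAdd n 0))
      then F.conn (F.input (Fin.natAdd 1 (Fin.castAdd m 0))) else F.conn x) := fun x => by
    rw [traceStep, ← hi1, ← ho1, ← h.conn, ← h.conn, apply_ite h.vs]
    simp only [h.vs.injective.eq_iff]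
  ofMaps (F := TypedHypergraph.traceOne (TypedHypergraph.traceOne F))
    (G := TypedHypergraph.traceOne (TypedHypergraph.traceOne G))
    (fun v => ⟨⟨h.vt v.1.1, h1 v⟩, h1' v⟩) (fun v => ⟨⟨h.vs v.1.1, h2 v⟩, h2' v⟩) h.e
    (((h.left.comp ((FibreMap.val _ _).comp (FibreMap.val _ _))).codRestrict _ h1).codRestrict
      (fun v => v ≠ (TypedHypergraph.traceOne G).firstInput) h1')
    (((h.right.comp ((FibreMap.val _ _).comp (FibreMap.val _ _))).codRestrict _ h2).codRestrict
      (fun v => v ≠ (TypedHypergraph.traceOne G).firstOutput) h2')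
    (fun i => by
      apply Subtype.ext
      apply Subtype.ext
      refine (congrArg h.vt (traceOne_traceOne_input F i)).trans ?_
      refine ((h.input _).trans (congrArg _ (hπ2 i))).trans ?_
      exact (traceOne_traceOne_input G i).symm)
    (fun i => by
      apply Subtype.ext
      apply Subtype.ext
      refine (congrArg h.vs (traceOne_traceOne_output F i)).trans ?_
      refine ((h.output _).trans (congrArg _ (hρ2 i))).trans ?_
      exact (traceOne_traceOne_output G i).symm)
    (fun v => by
      apply Subtype.ext
      apply Subtype.ext
      refine (congrArg (fun x => h.vs x.1) (traceOne_conn (TypedHypergraph.traceOne F) v)).trans ?_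
      refine Eq.trans ?_ (congrArg Subtype.val
        (traceOne_conn (TypedHypergraph.traceOne G) _)).symm
      refine (congrArg h.vs (traceOne_traceStep F v.1)).trans ?_
      refine Eq.trans ?_ (traceOne_traceStep G _).symm
      rw [hstep, ← hi0, hstep, ← ho0]
      simp only [h.vs.injective.eq_iff]
      rw [← apply_ite h.vs]
      refine congrArg h.vs ?_
      -- Everything now concerns vertices of `F`, and the two sides close its first two wires in
      -- opposite orders.
      refine eq_of_step_eq_step F.conn.injective ?_ ?_ v.1.2 ?_
      · exact (F.input_natAdd_ne_firstInput _).symm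
      · exact (F.output_natAdd_ne_firstOutput _).symm
      · intro h'
        refine v.2 (Subtype.ext ?_)
        rw [h', ← firstInput_traceOne])
    h.label

end WireIso

/-! ### Congruence for isomorphisms of hypergraphs -/

/-- Only the values of `π` and `ρ` are constrained, so the types may be equal merely
propositionally. This is what makes associativity and unit laws strict without transporting
hypergraphs. -/
theorem WireIso.hypIso {π : Fin m ≃ Fin m'} {ρ : Fin n ≃ Fin n'} {F : TypedHypergraph S m n}
    {G : TypedHypergraph S m' n'} (h : WireIso π ρ F G) (hπ : ∀ i, (π i : ℕ) = i)
    (hρ : ∀ i, (ρ i : ℕ) = i) : HypIso F.toLabelledHypergraph G.toLabelledHypergraph := by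
  obtain rfl : m = m' := by simpa using Fintype.card_congr π
  obtain rfl : n = n' := by simpa using Fintype.card_congr ρ
  exact hypIso_iff.2 ⟨h.congr hπ hρ⟩

/-- `HypIso` does not mention the types, but the lengths of the interface lists recover them. The
congruence lemmas can thus be stated between different types. -/
theorem eq_of_hypIso {F : TypedHypergraph S m n} {G : TypedHypergraph S m' n'}
    (h : HypIso F.toLabelledHypergraph G.toLabelledHypergraph) : m = m' ∧ n = n' := by
  obtain ⟨h, -, -, -, h4, h5⟩ := h
  rw [← ofFn_input, ← ofFn_input] at h4
  rw [← ofFn_output, ← ofFn_output] at h5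
  exact ⟨by simpa using congrArg List.length h4, by simpa using congrArg List.length h5⟩

theorem hypIso_comp {F : TypedHypergraph S m n} {F' : TypedHypergraph S m' n'}
    {G : TypedHypergraph S n p} {G' : TypedHypergraph S n' p'}
    (h : HypIso F.toLabelledHypergraph F'.toLabelledHypergraph)
    (k : HypIso G.toLabelledHypergraph G'.toLabelledHypergraph) :
    HypIso (F.comp G).toLabelledHypergraph (F'.comp G').toLabelledHypergraph := by
  obtain ⟨rfl, rfl⟩ := eq_of_hypIso h
  obtain ⟨-, rfl⟩ := eq_of_hypIso k
  obtain ⟨h⟩ := hypIso_iff.1 h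
  obtain ⟨k⟩ := hypIso_iff.1 k
  exact hypIso_iff.2 ⟨h.comp k⟩

@[simp] theorem finSumCongr_refl :
    finSumCongr (Equiv.refl (Fin m)) (Equiv.refl (Fin n)) = Equiv.refl _ := by
  ext i
  induction i using Fin.addCases <;> simp

theorem hypIso_tensor {F : TypedHypergraph S m n} {F' : TypedHypergraph S m' n'}
    {G : TypedHypergraph S p q} {G' : TypedHypergraph S p' q'}
    (h : HypIso F.toLabelledHypergraph F'.toLabelledHypergraph)
    (k : HypIso G.toLabelledHypergraph G'.toLabelledHypergraph) :
    HypIso (F.tensor G).toLabelledHypergraph (F'.tensor G').toLabelledHypergraph := by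
  obtain ⟨rfl, rfl⟩ := eq_of_hypIso h
  obtain ⟨rfl, rfl⟩ := eq_of_hypIso k
  obtain ⟨h⟩ := hypIso_iff.1 h
  obtain ⟨k⟩ := hypIso_iff.1 k
  exact (h.tensor k).hypIso (by simp) (by simp)

theorem hypIso_traceOne {F : TypedHypergraph S (1 + m) (1 + n)}
    {G : TypedHypergraph S (1 + m') (1 + n')}
    (h : HypIso F.toLabelledHypergraph G.toLabelledHypergraph) :
    HypIso (traceOne F).toLabelledHypergraph (traceOne G).toLabelledHypergraph := by
  obtain ⟨h1, h2⟩ := eq_of_hypIso h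
  obtain rfl := Nat.add_left_cancel h1
  obtain rfl := Nat.add_left_cancel h2
  obtain ⟨h⟩ := hypIso_iff.1 h
  exact hypIso_iff.2 ⟨h.traceOne _ _ rfl rfl (fun _ => rfl) (fun _ => rfl)⟩

/-- `cast` leaves the labelled hypergraph unchanged, so `HypIso.refl` relates a hypergraph to any of
its casts; with this lemma casts can be moved freely under a trace. -/
theorem hypIso_trace {x x' : ℕ} (hx : x = x') {m n m' n' : ℕ}
    {F : TypedHypergraph S (x + m) (x + n)}
    {G : TypedHypergraph S (x' + m') (x' + n')}
    (h : HypIso F.toLabelledHypergraph G.toLabelledHypergraph) :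
    HypIso (trace x F).toLabelledHypergraph (trace x' G).toLabelledHypergraph := by
  subst hx
  induction x generalizing m n m' n' with
  | zero => exact h
  | succ x ih => exact hypIso_traceOne (ih h)

/-! ### The trace of several wires -/

theorem hypIso_identity_tensor (x : ℕ) (G : TypedHypergraph S p m) :
    HypIso ((identity S (x + 1)).tensor G).toLabelledHypergraph
      ((identity S x).tensor ((identity S 1).tensor G)).toLabelledHypergraph :=
  (hypIso_tensor (hypIso_iff.2 ⟨WireIso.tensorId x 1⟩).symm (HypIso.refl _)).trans
    ((WireIso.tensorAssoc _ _ G).hypIso (by simp) (by simp))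

/-- The block transposition with an empty block moves nothing, so commutativity reduces the left
unit to the right unit. -/
theorem hypIso_unit_tensor (G : TypedHypergraph S p m) :
    HypIso ((identity S 0).tensor G).toLabelledHypergraph G.toLabelledHypergraph := by
  refine ((WireIso.tensorComm _ _).trans (WireIso.tensorUnit G)).hypIso ?_ ?_
  all_goals
    intro i
    exact (finAddFlip_val (m := 0) i).trans (by simp)

/-- Splitting one wire off the identity makes `G` tensored with that wire the new morphism to pull
out. The induction hypothesis pulls it out of the first `x` traces, and the one-wire law out of the
last. -/
theorem hypIso_tighteningLeft (x : ℕ) {m n p : ℕ} (G : TypedHypergraph S p m)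
    (F : TypedHypergraph S (x + m) (x + n)) :
    HypIso (trace x (((identity S x).tensor G).comp F)).toLabelledHypergraph
      (G.comp (trace x F)).toLabelledHypergraph := by
  induction x generalizing m n p with
  | zero =>
    exact hypIso_comp (G' := F.cast (Nat.zero_add _) (Nat.zero_add _)) (hypIso_unit_tensor G)
      (HypIso.refl _)
  | succ x ih =>
    refine HypIso.trans (hypIso_traceOne (hypIso_trace rfl ?_)) ((hypIso_traceOne
      (ih ((identity S 1).tensor G) (F.cast (Nat.add_assoc _ _ _) (Nat.add_assoc _ _ _)))).trans
      (hypIso_iff.2 ⟨WireIso.tighteningLeftOne G _⟩).symm)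
    exact hypIso_comp (G' := F.cast (Nat.add_assoc _ _ _) (Nat.add_assoc _ _ _))
      (hypIso_identity_tensor x G) (HypIso.refl _)

theorem hypIso_tighteningRight (x : ℕ) {m n q : ℕ} (F : TypedHypergraph S (x + m) (x + n))
    (H : TypedHypergraph S n q) :
    HypIso (trace x (F.comp ((identity S x).tensor H))).toLabelledHypergraph
      ((trace x F).comp H).toLabelledHypergraph := by
  induction x generalizing m n q with
  | zero =>
    exact hypIso_comp (F' := F.cast (Nat.zero_add _) (Nat.zero_add _)) (HypIso.refl _)
      (hypIso_unit_tensor H)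
  | succ x ih =>
    refine HypIso.trans (hypIso_traceOne (hypIso_trace rfl ?_)) ((hypIso_traceOne
      (ih (F.cast (Nat.add_assoc _ _ _) (Nat.add_assoc _ _ _)) ((identity S 1).tensor H))).trans
      (hypIso_iff.2 ⟨WireIso.tighteningRightOne _ H⟩).symm)
    exact hypIso_comp (F' := F.cast (Nat.add_assoc _ _ _) (Nat.add_assoc _ _ _))
      (HypIso.refl _) (hypIso_identity_tensor x H)

theorem hypIso_superposing (x : ℕ) {m n p q : ℕ} (F : TypedHypergraph S (x + m) (x + n))
    (G : TypedHypergraph S p q) :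
    HypIso (trace x ((F.tensor G).cast (Nat.add_assoc _ _ _)
      (Nat.add_assoc _ _ _))).toLabelledHypergraph ((trace x F).tensor G).toLabelledHypergraph := by
  induction x generalizing m n p q with
  | zero =>
    exact hypIso_tensor (F' := F.cast (Nat.zero_add _) (Nat.zero_add _)) (HypIso.refl _)
      (HypIso.refl _)
  | succ x ih =>
    refine HypIso.trans (hypIso_traceOne (G := (tensor (trace x (F.cast (Nat.add_assoc _ _ _)
      (Nat.add_assoc _ _ _))) G).cast (Nat.add_assoc _ _ _) (Nat.add_assoc _ _ _)) ?_)
      (hypIso_iff.2 ⟨WireIso.superposingOne _ G⟩).symm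
    refine HypIso.trans (hypIso_trace rfl ?_) (ih (F.cast (Nat.add_assoc _ _ _)
      (Nat.add_assoc _ _ _)) G)
    exact hypIso_tensor (F' := F.cast (Nat.add_assoc _ _ _) (Nat.add_assoc _ _ _)) (HypIso.refl _)
      (HypIso.refl _)

/-- Each trace closes the current first wire, so closing `x + y` wires is closing the first `x` and
then the next `y`; only bracketings of the types intervene. -/
theorem hypIso_trace_add (x y : ℕ) {m n : ℕ} (F : TypedHypergraph S (x + y + m) (x + y + n)) :
    HypIso (trace (x + y) F).toLabelledHypergraph
      (trace y (trace x (F.cast (Nat.add_assoc _ _ _) (Nat.add_assoc _ _ _)))).toLabelledHypergraph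
    := by
  induction y generalizing m n with
  | zero =>
    exact hypIso_trace (F := F) (G := F.cast (Nat.add_assoc x 0 m) (Nat.add_assoc x 0 n)) rfl
      (HypIso.refl _)
  | succ y ih =>
    refine HypIso.trans (hypIso_traceOne (ih (F.cast (Nat.add_assoc (x + y) 1 m)
      (Nat.add_assoc (x + y) 1 n)))) (hypIso_traceOne (hypIso_trace rfl ?_))
    exact hypIso_trace (m := y + (1 + m)) (n := y + (1 + n)) (m' := y + 1 + m) (n' := y + 1 + n)
      rfl (HypIso.refl _)

/-! ### Hypergraphs without edges -/

/-- A hypergraph without edges whose `i`th input is connected to its `f i`th output. -/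
structure IsWiring (f : ℕ → ℕ) (A : TypedHypergraph S m n) : Prop where
  isEmpty : IsEmpty A.E
  conn : ∀ i : Fin m, ∃ j : Fin n, (j : ℕ) = f i ∧ A.conn (A.input i) = A.output j

theorem left_eq_none {A : TypedHypergraph S m n} [IsEmpty A.E] (v : A.Vt) : A.left v = none := by
  cases h : A.left v with
  | none => rfl
  | some e => exact isEmptyElim e

theorem right_eq_none {A : TypedHypergraph S m n} [IsEmpty A.E] (v : A.Vs) : A.right v = none := by
  cases h : A.right v with
  | none => rfl
  | some e => exact isEmptyElim e

/-- An isomorphism between hypergraphs without edges. -/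
noncomputable def WireIso.ofIsEmpty {π : Fin m ≃ Fin m'} {ρ : Fin n ≃ Fin n'}
    {A : TypedHypergraph S m n} {B : TypedHypergraph S m' n'} (hA : IsEmpty A.E)
    (hB : IsEmpty B.E)
    (h : ∀ i, ∃ j, A.conn (A.input i) = A.output j ∧ B.conn (B.input (π i)) = B.output (ρ j)) :
    WireIso π ρ A B :=
  ofMaps (fun v => B.input (π (A.inputIndex v (left_eq_none v))))
    (fun v => B.output (ρ (A.outputIndex v (right_eq_none v))))
    (Equiv.equivOfIsEmpty _ _)
    (FibreMap.of_none left_eq_none (fun _ => left_eq_none _))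
    (FibreMap.of_none right_eq_none (fun _ => right_eq_none _))
    (fun i => by simp) (fun i => by simp)
    (fun v => by
      obtain ⟨i, rfl⟩ := A.exists_input (left_eq_none v)
      obtain ⟨j, h1, h2⟩ := h i
      simp only [inputIndex_input, h2, h1, outputIndex_output])
    (fun x => isEmptyElim x)

namespace IsWiring

variable {f g : ℕ → ℕ}

/-- Interface permutations may absorb the wiring: in this form a swap becomes an identity with one
block-transposed interface. -/
theorem wireIso {A : TypedHypergraph S m n} {B : TypedHypergraph S m' n'} (hA : IsWiring f A)
    (hB : IsWiring g B) {π : Fin m ≃ Fin m'} {ρ : Fin n ≃ Fin n'}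
    (h : ∀ (i : Fin m) (j : Fin n), (j : ℕ) = f i → (ρ j : ℕ) = g (π i)) : Nonempty
        (WireIso π ρ A B) := by
  refine ⟨WireIso.ofIsEmpty hA.isEmpty hB.isEmpty fun i => ?_⟩
  obtain ⟨j, hj, h1⟩ := hA.conn i
  obtain ⟨k, hk, h2⟩ := hB.conn (π i)
  refine ⟨j, h1, ?_⟩
  rw [h2]
  exact congrArg _ (Fin.ext (hk.trans (h i j hj).symm))

/-- The wiring function determines an edgeless hypergraph. As it is a function on natural numbers,
insensitive to casts, coherence laws become piecewise linear identities. -/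
theorem hypIso {A : TypedHypergraph S m n} {B : TypedHypergraph S m n} (hA : IsWiring f A)
    (hB : IsWiring g B) (h : ∀ i < m, f i = g i) :
    HypIso A.toLabelledHypergraph B.toLabelledHypergraph :=
  hypIso_iff.2 (hA.wireIso hB fun i _ hj => hj.trans (h i i.2))

theorem congr {A : TypedHypergraph S m n} (hA : IsWiring f A) (h : ∀ i < m, f i = g i) :
    IsWiring g A :=
  ⟨hA.isEmpty, fun i => by
    obtain ⟨j, hj, h1⟩ := hA.conn i
    exact ⟨j, hj.trans (h i i.2), h1⟩⟩

theorem cast {A : TypedHypergraph S m n} (hA : IsWiring f A) (hm : m = m') (hn : n = n') :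
    IsWiring f (A.cast hm hn) := by
  subst hm hn
  exact hA

theorem edgeless (σ : Equiv.Perm (Fin n)) (h : ∀ i, (σ i : ℕ) = f i) :
    IsWiring f (edgeless S n σ) :=
  ⟨inferInstanceAs (IsEmpty Empty), fun i => ⟨σ i, h i, by
    rw [edgeless_input, edgeless_output]; rfl⟩⟩

theorem identity (n : ℕ) : IsWiring _root_.id (identity S n) := edgeless _ fun _ => rfl

theorem comp {A : TypedHypergraph S m n} {B : TypedHypergraph S n p} (hA : IsWiring f A)
    (hB : IsWiring g B) : IsWiring (fun i => g (f i)) (A.comp B) := by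
  have := hA.isEmpty
  have := hB.isEmpty
  refine ⟨inferInstanceAs (IsEmpty (A.E ⊕ B.E)), fun i => ?_⟩
  obtain ⟨j, hj, h1⟩ := hA.conn i
  obtain ⟨k, hk, h2⟩ := hB.conn j
  refine ⟨k, by rw [hk, hj], ?_⟩
  rw [comp_input, comp_output, ← h2]
  exact comp_conn_inl_of_eq A B h1

theorem tensor {A : TypedHypergraph S m n} {B : TypedHypergraph S p q} (hA : IsWiring f A)
    (hB : IsWiring g B) : IsWiring (fun i => if i < m then f i else n + g (i - m))
        (A.tensor B) := by
  have := hA.isEmpty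
  have := hB.isEmpty
  refine ⟨inferInstanceAs (IsEmpty (A.E ⊕ B.E)), fun i => ?_⟩
  induction i using Fin.addCases with
  | left i =>
    obtain ⟨j, hj, h1⟩ := hA.conn i
    refine ⟨Fin.castAdd q j, by simp [hj], ?_⟩
    rw [tensor_input_castAdd, tensor_output_castAdd]
    exact congrArg (fun x => toLex (Sum.inl x)) h1
  | right i =>
    obtain ⟨j, hj, h1⟩ := hB.conn i
    refine ⟨Fin.natAdd n j, by simp [hj], ?_⟩
    rw [tensor_input_natAdd, tensor_output_natAdd]
    exact congrArg (fun x => toLex (Sum.inr x)) h1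

/-- The truncated subtractions are harmless: `A.conn` is injective, so if `f (i + 1) = 0` the first
input is not also connected to the first output, and `f 0` is positive. In the proof this is
`traceStep_ne`, which excludes the deleted output as an endpoint. -/
theorem traceOne {A : TypedHypergraph S (1 + m) (1 + n)} (hA : IsWiring f A) :
    IsWiring (fun i => if f (i + 1) = 0 then f 0 - 1 else f (i + 1) - 1) (traceOne A) := by
  refine ⟨hA.isEmpty, fun i => ?_⟩
  have key : ∀ k : Fin (1 + n), A.traceStep (A.input (Fin.natAdd 1 i)) = A.output k →
      ∃ j : Fin n, (j : ℕ) = k - 1 ∧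
        (TypedHypergraph.traceOne A).conn ((TypedHypergraph.traceOne A).input i) =
          (TypedHypergraph.traceOne A).output j := fun k hk => by
    induction k using Fin.addCases with
    | left k =>
      refine absurd hk ?_
      rw [Subsingleton.elim k 0]
      exact A.traceStep_ne (A.input_natAdd_ne_firstInput i)
    | right k =>
      refine ⟨k, by simp, ?_⟩
      rw [traceOne_input, traceOne_output]
      exact Subtype.ext ((traceOne_conn A _).trans hk)
  obtain ⟨j, hj, h1⟩ := hA.conn (Fin.natAdd 1 i)
  have hv : ((Fin.natAdd 1 i : Fin (1 + m)) : ℕ) = i + 1 := by simp [Nat.add_comm]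
  rw [hv] at hj
  split_ifs with h
  · obtain ⟨k, hk, h2⟩ := hA.conn (Fin.castAdd m 0)
    obtain ⟨l, hl, h3⟩ := key k ((traceStep_of_eq A (h1.trans
      (congrArg _ (Fin.ext (hj.trans h) : j = Fin.castAdd n 0)))).trans h2)
    exact ⟨l, by rw [hl, hk]; rfl, h3⟩
  · obtain ⟨l, hl, h3⟩ := key j ((traceStep_of_ne A (fun h' => h (by
      have := A.output_strictMono.injective (h1.symm.trans h')
      rw [← hj, this]))).trans h1)
    exact ⟨l, by rw [hl, hj], h3⟩

theorem swapOneOne : IsWiring (fun i => 1 - i) (swapOneOne S) :=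
  edgeless _ fun i => by fin_cases i <;> rfl

theorem swapManyOne (m : ℕ) : IsWiring (fun i => if i < m then i + 1 else 0) (swapManyOne S m) := by
  induction m using Nat.strong_induction_on with
  | _ m ih =>
    match m with
    | 0 =>
      rw [TypedHypergraph.swapManyOne]
      exact ((identity 1).cast _ _).congr fun i hi => by
        dsimp only [id]
        split_ifs <;> omega
    | 1 =>
      rw [TypedHypergraph.swapManyOne]
      exact swapOneOne.congr fun i hi => by split_ifs <;> omega
    | m + 2 =>
      rw [TypedHypergraph.swapManyOne]
      refine ((((identity _).tensor swapOneOne).comp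
        (((ih (m + 1) (by omega)).tensor (identity 1)).cast _ _)).cast _ _).congr fun i hi => ?_
      dsimp only [id]
      split_ifs <;> omega

theorem swapOneMany (n : ℕ) : IsWiring (fun i => if i = 0 then n else i - 1) (swapOneMany S n) := by
  induction n using Nat.strong_induction_on with
  | _ n ih =>
    match n with
    | 0 =>
      rw [TypedHypergraph.swapOneMany]
      exact ((identity 1).cast _ _).congr fun i hi => by
        dsimp only [id]
        split_ifs <;> omega
    | 1 =>
      rw [TypedHypergraph.swapOneMany]
      exact swapOneOne.congr fun i hi => by split_ifs <;> omega
    | n + 2 =>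
      rw [TypedHypergraph.swapOneMany]
      refine ((((ih (n + 1) (by omega)).tensor (identity 1)).comp
        (((identity _).tensor swapOneOne).cast _ _)).cast _ _).congr fun i hi => ?_
      dsimp only [id]
      split_ifs <;> omega

/-- The recursion for the swap is unfolded only here; everything later uses the resulting block
transposition. -/
theorem compositeSwap : ∀ m n : ℕ,
    IsWiring (fun i => if i < m then n + i else i - m) (compositeSwap S m n)
  | 0, n => by
    rw [TypedHypergraph.compositeSwap]
    exact ((identity n).cast _ _).congr fun i hi => by simp
  | m + 1, 0 => by
    rw [TypedHypergraph.compositeSwap]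
    exact ((identity (m + 1)).cast _ _).congr fun i hi => by
      dsimp only [id]
      split_ifs <;> omega
  | 1, n + 1 => by
    rw [TypedHypergraph.compositeSwap]
    exact (swapOneMany (n + 1)).congr fun i hi => by split_ifs <;> omega
  | m + 2, 1 => by
    rw [TypedHypergraph.compositeSwap]
    exact (swapManyOne (m + 2)).congr fun i hi => by split_ifs <;> omega
  | m + 2, n + 2 => by
    rw [TypedHypergraph.compositeSwap]
    refine ((((((identity _).tensor (swapOneMany (n + 1))).tensor (identity 1)).comp
      (((compositeSwap (m + 1) (n + 1)).tensor swapOneOne).cast _ _)).comp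
      ((((identity _).tensor (swapManyOne (m + 1))).tensor (identity 1)).cast _ _)).cast
        _ _).congr fun i hi => ?_
    dsimp only [id]
    split_ifs <;> omega

/-- After `k` traces, position `i` is the original input `i + k`. If `i + k < x`, its wire still
ends in the second half. Otherwise it ran to the original output `i + k - x`: for `i < x` that
output has been closed and feedback leads to position `i`, and for `i ≥ x` it survives. At `k = x`
only the middle case remains, which is the identity. -/
theorem trace_rotation (x k : ℕ) {m : ℕ} {A : TypedHypergraph S (k + m) (k + m)} (hk : k ≤ x)
    (hm : k + m = x + x) (hA : IsWiring (fun i => if i < x then x + i else i - x) A) :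
    IsWiring (fun i => if i + k < x then x + i else if i < x then i else i - x) (trace k A) := by
  induction k generalizing m with
  | zero =>
    refine (hA.cast _ _).congr fun i hi => ?_
    split_ifs <;> omega
  | succ k ih =>
    refine (ih (A := A.cast (Nat.add_assoc _ _ _) (Nat.add_assoc _ _ _)) (by omega) (by omega)
      (hA.cast _ _)).traceOne.congr fun i hi => ?_
    split_ifs <;> first | contradiction | omega

end IsWiring

/-! ### Permuting the traced wires -/

/-- Wires are closed one at a time. In the induction the last traced wire joins `π` and `ρ` as a
fixed block, until the one-wire trace removes it. -/
theorem WireIso.nonempty_trace (x : ℕ) {m n m' n' : ℕ} {π : Fin m ≃ Fin m'} {ρ : Fin n ≃ Fin n'}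
    {F : TypedHypergraph S (x + m) (x + n)} {G : TypedHypergraph S (x + m') (x + n')}
    (h : WireIso (finSumCongr (Equiv.refl _) π) (finSumCongr (Equiv.refl _) ρ) F G) :
    Nonempty (WireIso π ρ (trace x F) (trace x G)) := by
  induction x generalizing m n m' n' with
  | zero =>
    refine ⟨(((WireIso.ofCast F _ _).trans h).trans (WireIso.ofCast G _ _).symm).congr ?_ ?_⟩ <;>
    · intro i
      simp [finSumCongr_val]
  | succ x ih =>
    have h' : WireIso (finSumCongr (Equiv.refl _) (finSumCongr (Equiv.refl (Fin 1)) π))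
        (finSumCongr (Equiv.refl _) (finSumCongr (Equiv.refl (Fin 1)) ρ))
        (F.cast (Nat.add_assoc _ _ _) (Nat.add_assoc _ _ _))
        (G.cast (Nat.add_assoc _ _ _) (Nat.add_assoc _ _ _)) := by
      refine (((WireIso.ofCast F _ _).trans h).trans (WireIso.ofCast G _ _).symm).congr ?_ ?_ <;>
      · intro i
        simp only [Equiv.trans_apply, finSumCongr_val, finCongr_apply, Fin.val_cast,
          Equiv.refl_apply, finCongr_symm]
        split_ifs <;> first | omega | skip
        rw [Nat.add_assoc]
        simp only [Nat.sub_sub]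
    obtain ⟨h'⟩ := ih h'
    exact ⟨h'.traceOne π ρ (by simp) (by simp) (by simp) (by simp)⟩

/-- The relabelled hypergraph is `F` composed on both sides with edgeless permutations. It is needed
to factor an isomorphism over a product of permutations. -/
theorem exists_wireIso (π : Fin m ≃ Fin m') (ρ : Fin n ≃ Fin n') (F : TypedHypergraph S m n) :
    ∃ G : TypedHypergraph S m' n', Nonempty (WireIso π ρ F G) := by
  obtain rfl : m = m' := by simpa using Fintype.card_congr π
  obtain rfl : n = n' := by simpa using Fintype.card_congr ρ
  -- The inverse appears because the relabelled input `π i` must still be connected to wire `i` of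
  -- `F`.
  have h1 : WireIso π (Equiv.refl _) (identity S m) (edgeless S m π.symm) :=
    WireIso.ofIsEmpty (inferInstanceAs (IsEmpty Empty)) (inferInstanceAs (IsEmpty Empty))
      fun i => ⟨i, identity_conn_input i, by
        rw [edgeless_input, edgeless_output]; exact π.symm_apply_apply i⟩
  have h2 : WireIso (Equiv.refl _) ρ (identity S n) (edgeless S n ρ) :=
    WireIso.ofIsEmpty (inferInstanceAs (IsEmpty Empty)) (inferInstanceAs (IsEmpty Empty))
      fun i => ⟨i, identity_conn_input i, by
        rw [edgeless_input, edgeless_output]; rfl⟩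
  exact ⟨((edgeless S m π.symm).comp F).comp (edgeless S n ρ),
    ⟨((WireIso.compId F).symm.trans (((WireIso.idComp F).symm.trans
      (h1.comp (WireIso.refl F))).comp h2)).congr (fun _ => rfl) (fun _ => rfl)⟩⟩

/-- The trace is cut into the first `i` wires, which are fixed, the transposed pair, where
`WireIso.traceOneTraceOne` applies, and the remaining `r` wires, closed on isomorphic hypergraphs.
-/
theorem hypIso_trace_of_swap (i r : ℕ) {m n : ℕ}
    {F G : TypedHypergraph S (i + 2 + r + m) (i + 2 + r + n)}
    {π : Equiv.Perm (Fin (i + 2 + r + m))} {ρ : Equiv.Perm (Fin (i + 2 + r + n))}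
    (hπ : ∀ j, (π j : ℕ) = if (j : ℕ) = i then i + 1 else if (j : ℕ) = i + 1 then i else j)
    (hρ : ∀ j, (ρ j : ℕ) = if (j : ℕ) = i then i + 1 else if (j : ℕ) = i + 1 then i else j)
    (h : WireIso π ρ F G) :
    HypIso (trace (i + 2 + r) F).toLabelledHypergraph
      (trace (i + 2 + r) G).toLabelledHypergraph := by
  have hm : ∀ m, i + 2 + r + m = i + (1 + (1 + (r + m))) := fun m => by omega
  have h' : WireIso
      (finSumCongr (Equiv.refl _)
        (Equiv.swap (Fin.castAdd _ 0) (Fin.natAdd 1 (Fin.castAdd (r + m) 0))))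
      (finSumCongr (Equiv.refl _)
        (Equiv.swap (Fin.castAdd _ 0) (Fin.natAdd 1 (Fin.castAdd (r + n) 0))))
      (F.cast (hm _) (hm _)) (G.cast (hm _) (hm _)) := by
    refine (((WireIso.ofCast F _ _).trans h).trans (WireIso.ofCast G _ _).symm).congr ?_ ?_ <;>
    · intro j
      simp only [Equiv.trans_apply, finSumCongr_val, finCongr_apply, Fin.val_cast, hπ, hρ,
        Equiv.refl_apply, finCongr_symm, Equiv.swap_apply_def, Fin.ext_iff, Fin.val_castAdd,
        Fin.val_natAdd, Fin.val_zero, apply_ite Fin.val]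
      split_ifs <;> omega
  obtain ⟨h'⟩ := WireIso.nonempty_trace i h'
  have h2 := (h'.traceOneTraceOne (Equiv.swap_apply_left _ _) (Equiv.swap_apply_right _ _)
    (fun j => Equiv.swap_apply_of_ne_of_ne (by simp [Fin.ext_iff]) (by simp [Fin.ext_iff]))
    (Equiv.swap_apply_left _ _) (Equiv.swap_apply_right _ _)
    (fun j => Equiv.swap_apply_of_ne_of_ne (by simp [Fin.ext_iff]) (by simp [Fin.ext_iff])))
  have key : ∀ F : TypedHypergraph S (i + 2 + r + m) (i + 2 + r + n),
      HypIso (trace (i + 2 + r) F).toLabelledHypergraph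
      (trace r (traceOne (traceOne (trace i (F.cast (hm _) (hm _)))))).toLabelledHypergraph :=
    fun F => (hypIso_trace_add (i + 2) r F).trans (hypIso_trace rfl
      (hypIso_traceOne (hypIso_traceOne (hypIso_trace (m := 1 + (1 + (r + m)))
        (n := 1 + (1 + (r + n))) rfl (HypIso.refl _)))))
  exact (key F).trans ((hypIso_trace rfl (hypIso_iff.2 ⟨h2⟩)).trans (key G).symm)

/-- Adjacent transpositions generate the symmetric group, and the permutations that leave the trace
unchanged for all `F` and `G` are closed under products. -/
theorem hypIso_trace_of_perm {x : ℕ} (σ : Equiv.Perm (Fin x)) {m n : ℕ}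
    {F G : TypedHypergraph S (x + m) (x + n)}
    (h : WireIso (finSumCongr σ (Equiv.refl _)) (finSumCongr σ (Equiv.refl _)) F G) :
    HypIso (trace x F).toLabelledHypergraph (trace x G).toLabelledHypergraph := by
  cases x with
  | zero =>
    refine hypIso_trace rfl (h.hypIso ?_ ?_) <;>
    · intro i
      simp [finSumCongr_val]
  | succ x =>
    have hσ : σ ∈ Submonoid.closure
        (Set.range fun i : Fin x => Equiv.swap i.castSucc i.succ) := by
      rw [Equiv.Perm.mclosure_swap_castSucc_succ]
      trivial
    induction hσ using Submonoid.closure_induction generalizing F G with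
    | mem σ hσ =>
      obtain ⟨i, rfl⟩ := hσ
      -- `r` counts the traced wires after the transposed pair.
      obtain ⟨r, hr⟩ : ∃ r, x + 1 = (i : ℕ) + 2 + r := ⟨x - 1 - i, by omega⟩
      have h' := ((WireIso.ofCast F (congrArg (· + m) hr) (congrArg (· + n) hr)).trans h).trans
        (WireIso.ofCast G (congrArg (· + m) hr) (congrArg (· + n) hr)).symm
      refine (hypIso_trace hr (HypIso.refl _)).trans ((hypIso_trace_of_swap i r ?_ ?_ h').trans
        (hypIso_trace hr.symm (HypIso.refl _))) <;>
      · intro j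
        simp only [Equiv.trans_apply, finSumCongr_val, finCongr_apply, Fin.val_cast,
          Equiv.refl_apply, finCongr_symm, Equiv.swap_apply_def, Fin.ext_iff, Fin.val_castSucc,
          Fin.val_succ, apply_ite Fin.val]
        split_ifs <;> omega
    | one =>
      refine hypIso_trace rfl (h.hypIso ?_ ?_) <;>
      · intro i
        simp [finSumCongr_val]
        try omega
    | mul σ τ _ _ hσ hτ =>
      -- `H` is `F` relabelled by `τ` alone, so that `F` and `H` differ by `τ`, and `H` and `G` by
      -- `σ`.
      obtain ⟨H, ⟨k⟩⟩ := exists_wireIso (finSumCongr τ (Equiv.refl _))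
        (finSumCongr τ (Equiv.refl _)) F
      refine (hτ k).trans (hσ ((k.symm.trans h).congr ?_ ?_)) <;>
      · intro i
        induction i using Fin.addCases <;> simp

end TypedHypergraph

theorem finAddFlip_finAddFlip {m n : ℕ} (i : Fin (m + n)) : finAddFlip (finAddFlip i) = i := by
  induction i using Fin.addCases <;> simp

theorem finAddFlip_symm {m n : ℕ} :
    (finAddFlip : Fin (m + n) ≃ Fin (n + m)).symm = finAddFlip := by
  ext i
  exact congrArg Fin.val ((Equiv.symm_apply_eq _).2 (finAddFlip_finAddFlip i).symm)

namespace TypedHypergraph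

variable {S : HypSignature.{u}} {m n p q r s m' n' p' q' : ℕ}

/-! ### Symmetry and exchange -/

/-- The left side is `F ⊗ G` with transposed output blocks and the right side is `G ⊗ F` with
transposed input blocks; `WireIso.tensorComm` identifies the two. -/
theorem hypIso_swap_natural (F : TypedHypergraph S m n) (G : TypedHypergraph S p q) :
    HypIso ((F.tensor G).comp (compositeSwap S n q)).toLabelledHypergraph
      ((compositeSwap S m p).comp (G.tensor F)).toLabelledHypergraph := by
  obtain ⟨h⟩ := (IsWiring.compositeSwap (S := S) n q).wireIso (IsWiring.identity (S := S) (n + q))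
    (π := Equiv.refl _) (ρ := finAddFlip) (fun i j hj => by
      rw [finAddFlip_val]
      simp only [Equiv.refl_apply, id]
      split_ifs at * <;> omega)
  obtain ⟨k⟩ := (IsWiring.compositeSwap (S := S) m p).wireIso (IsWiring.identity (S := S) (p + m))
    (π := finAddFlip) (ρ := Equiv.refl _) (fun i j hj => by
      rw [finAddFlip_val]
      simpa using hj)
  have h1 := ((WireIso.refl (F.tensor G)).comp h).trans (WireIso.compId _)
  have k1 := (k.comp (WireIso.refl (G.tensor F))).trans (WireIso.idComp _)
  refine ((h1.trans (WireIso.tensorComm F G)).trans k1.symm).hypIso (fun i => ?_) (fun i => ?_)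
  · simp
  · simp [finAddFlip_finAddFlip]

theorem hypIso_swap_swap (m n : ℕ) :
    HypIso ((compositeSwap S m n).comp (compositeSwap S n m)).toLabelledHypergraph
      (identity S (m + n)).toLabelledHypergraph :=
  ((IsWiring.compositeSwap m n).comp (IsWiring.compositeSwap n m)).hypIso (IsWiring.identity _)
    fun i hi => by
      dsimp only [id]
      split_ifs <;> omega

theorem hypIso_hexagon_left (m n p : ℕ) :
    HypIso (((compositeSwap S m n).tensor (identity S p)).comp
      (((identity S n).tensor (compositeSwap S m p)).cast (Nat.add_assoc n m p).symm
        (Nat.add_assoc n p m).symm)).toLabelledHypergraph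
      ((compositeSwap S m (n + p)).cast (Nat.add_assoc m n p).symm
        (Eq.refl (n + p + m))).toLabelledHypergraph :=
  (((IsWiring.compositeSwap m n).tensor (IsWiring.identity p)).comp
    (((IsWiring.identity n).tensor (IsWiring.compositeSwap m p)).cast _ _)).hypIso
    ((IsWiring.compositeSwap m (n + p)).cast _ _) fun i hi => by
      dsimp only [id]
      split_ifs <;> omega

theorem hypIso_hexagon_right (m n p : ℕ) :
    HypIso (((identity S m).tensor (compositeSwap S n p)).comp
      (((compositeSwap S m p).tensor (identity S n)).cast (Nat.add_assoc m p n)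
        (Nat.add_assoc p m n))).toLabelledHypergraph
      ((compositeSwap S (m + n) p).cast (Nat.add_assoc m n p)
        (Eq.refl (p + (m + n)))).toLabelledHypergraph :=
  (((IsWiring.identity m).tensor (IsWiring.compositeSwap n p)).comp
    (((IsWiring.compositeSwap m p).tensor (IsWiring.identity n)).cast _ _)).hypIso
    ((IsWiring.compositeSwap (m + n) p).cast _ _) fun i hi => by
      dsimp only [id]
      split_ifs <;> omega

theorem hypIso_yanking (x : ℕ) :
    HypIso (trace x (compositeSwap S x x)).toLabelledHypergraph
      (identity S x).toLabelledHypergraph :=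
  (IsWiring.trace_rotation x x le_rfl rfl (IsWiring.compositeSwap x x)).hypIso
    (IsWiring.identity x) fun i hi => by
      dsimp only [id]
      split_ifs <;> omega

/-- Both double traces are traces of `x + y` wires. Composing with the swaps on both sides only
permutes the traced inputs and outputs, in the same way, which `hypIso_trace_of_perm` ignores. -/
theorem hypIso_exchange (x y : ℕ) {m n : ℕ} (F : TypedHypergraph S (x + y + m) (x + y + n)) :
    HypIso (trace y (trace x (F.cast (Nat.add_assoc x y m)
      (Nat.add_assoc x y n)))).toLabelledHypergraph
      (trace x (trace y (((((compositeSwap S y x).tensor (identity S m)).comp F).comp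
        ((compositeSwap S x y).tensor (identity S n))).cast (Nat.add_assoc y x m)
          (Nat.add_assoc y x n)))).toLabelledHypergraph := by
  refine (hypIso_trace_add x y F).symm.trans (HypIso.trans ?_ (hypIso_trace_add y x
    ((((compositeSwap S y x).tensor (identity S m)).comp F).comp
        ((compositeSwap S x y).tensor (identity S n)))))
  obtain ⟨h⟩ := (IsWiring.compositeSwap (S := S) y x).wireIso (IsWiring.identity (S := S) (x + y))
    (π := finAddFlip) (ρ := Equiv.refl _) (fun i j hj => by
      rw [finAddFlip_val]
      simpa using hj)
  obtain ⟨k⟩ := (IsWiring.compositeSwap (S := S) x y).wireIso (IsWiring.identity (S := S) (x + y))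
    (π := Equiv.refl _) (ρ := finAddFlip) (fun i j hj => by
      rw [finAddFlip_val]
      simp only [Equiv.refl_apply, id]
      split_ifs at * <;> omega)
  have h1 := (h.tensor (WireIso.refl (identity S m))).trans (WireIso.tensorId _ _)
  have k1 := (k.tensor (WireIso.refl (identity S n))).trans (WireIso.tensorId _ _)
  rw [finSumCongr_refl] at h1 k1
  have h2 := (((h1.comp (WireIso.refl F)).trans (WireIso.idComp F)).comp k1).trans
    (WireIso.compId F)
  have hc : ∀ m, y + x + m = x + y + m := fun m => by omega
  have h3 := h2.symm.trans (WireIso.ofCast _ (hc m) (hc n)).symm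
  -- The block transposition lands in `Fin (y + x)`; the cast makes it a permutation of the traced
  -- wires.
  refine (hypIso_trace_of_perm (finAddFlip.trans (finCongr (Nat.add_comm y x)))
    (h3.congr (fun i => ?_) (fun i => ?_))).trans
    (hypIso_trace (Nat.add_comm x y) (HypIso.refl _))
  · induction i using Fin.addCases <;> simp [finAddFlip_symm]
  · induction i using Fin.addCases <;> simp [finAddFlip_symm]

theorem toClass_eq {F G : TypedHypergraph S m n} :
    F.toClass = G.toClass ↔ HypIso F.toLabelledHypergraph G.toLabelledHypergraph :=
  Quotient.eq (r := typedHypergraphSetoid S m n)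

theorem homCast_toClass (hm : m = m') (hn : n = n') (F : TypedHypergraph S m n) :
    homCast hm hn F.toClass = (F.cast hm hn).toClass := by
  subst hm hn
  rfl

end TypedHypergraph

/-! ### The traced PROP of isomorphism classes. -/

open TypedHypergraph in
/-- Isomorphism classes of linear hypergraphs form a traced PROP. -/
noncomputable def hypTracedPROP (S : HypSignature.{u}) : TracedPROP (HypClass S) where
  id n := (identity S n).toClass
  comp := Quotient.map₂ TypedHypergraph.comp fun _ _ h _ _ k => hypIso_comp h k
  tensor := Quotient.map₂ TypedHypergraph.tensor fun _ _ h _ _ k => hypIso_tensor h k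
  swap m n := (compositeSwap S m n).toClass
  trace x := Quotient.map (TypedHypergraph.trace x) fun _ _ h => hypIso_trace rfl h
  id_comp f := by
    induction f using Quotient.ind with | _ F
    exact toClass_eq.2 (hypIso_iff.2 ⟨WireIso.idComp F⟩)
  comp_id f := by
    induction f using Quotient.ind with | _ F
    exact toClass_eq.2 (hypIso_iff.2 ⟨WireIso.compId F⟩)
  comp_assoc f g h := by
    induction f using Quotient.ind with | _ F
    induction g using Quotient.ind with | _ G
    induction h using Quotient.ind with | _ H
    exact toClass_eq.2 (hypIso_iff.2 ⟨WireIso.compAssoc F G H⟩)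
  tensor_id m n := toClass_eq.2 (hypIso_iff.2 ⟨WireIso.tensorId m n⟩)
  tensor_comp f g h k := by
    induction f using Quotient.ind with | _ F
    induction g using Quotient.ind with | _ G
    induction h using Quotient.ind with | _ H
    induction k using Quotient.ind with | _ K
    exact toClass_eq.2 (hypIso_iff.2 ⟨WireIso.tensorComp F G H K⟩).symm
  unit_tensor f := by
    induction f using Quotient.ind with | _ F
    exact (homCast_toClass _ _ ((identity S 0).tensor F)).trans
      (toClass_eq.2 (hypIso_unit_tensor F))
  tensor_unit f := by
    induction f using Quotient.ind with | _ F
    exact (homCast_toClass _ _ (F.tensor (identity S 0))).trans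
      (toClass_eq.2 (hypIso_iff.2 ⟨WireIso.tensorUnit F⟩))
  tensor_assoc f g h := by
    induction f using Quotient.ind with | _ F
    induction g using Quotient.ind with | _ G
    induction h using Quotient.ind with | _ H
    exact (homCast_toClass _ _ ((F.tensor G).tensor H)).trans
      (toClass_eq.2 ((WireIso.tensorAssoc F G H).hypIso (by simp) (by simp)))
  swap_natural f g := by
    induction f using Quotient.ind with | _ F
    induction g using Quotient.ind with | _ G
    exact toClass_eq.2 (hypIso_swap_natural F G)
  swap_swap m n := toClass_eq.2 (hypIso_swap_swap m n)
  hexagon_left m n p := by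
    refine (congrArg _ (homCast_toClass _ _ ((identity S n).tensor (compositeSwap S m p)))).trans
      (Eq.trans ?_ (homCast_toClass _ _ (compositeSwap S m (n + p))).symm)
    exact toClass_eq.2 (hypIso_hexagon_left m n p)
  hexagon_right m n p := by
    refine (congrArg _ (homCast_toClass _ _ ((compositeSwap S m p).tensor (identity S n)))).trans
      (Eq.trans ?_ (homCast_toClass _ _ (compositeSwap S (m + n) p)).symm)
    exact toClass_eq.2 (hypIso_hexagon_right m n p)
  tightening x _ _ _ _ g f h := by
    induction f using Quotient.ind with | _ F
    induction g using Quotient.ind with | _ G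
    induction h using Quotient.ind with | _ H
    -- `H` is pulled out on the right, and then `G` on the left.
    exact toClass_eq.2 ((hypIso_tighteningRight x _ H).trans
      (hypIso_comp (hypIso_tighteningLeft x G F) (HypIso.refl _)))
  superposing x _ _ _ _ f g := by
    induction f using Quotient.ind with | _ F
    induction g using Quotient.ind with | _ G
    exact (congrArg _ (homCast_toClass _ _ (F.tensor G))).trans
      (toClass_eq.2 (hypIso_superposing x F G))
  yanking x := toClass_eq.2 (hypIso_yanking x)
  exchange x y _ _ f := by
    induction f using Quotient.ind with | _ F
    refine (congrArg _ (congrArg _ (homCast_toClass _ _ F))).trans (Eq.trans ?_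
      (congrArg _ (congrArg _ (homCast_toClass _ _
        ((((compositeSwap S y x).tensor (identity S _)).comp F).comp
          ((compositeSwap S x y).tensor (identity S _)))))).symm)
    exact toClass_eq.2 (hypIso_exchange x y F)

theorem theorem1 (S : HypSignature.{u}) :
    ∃ P : TracedPROP (HypClass S),
      (∀ n : ℕ, P.id n = (TypedHypergraph.identity S n).toClass) ∧
      P.id 0 = (TypedHypergraph.empty S).toClass ∧
      (∀ {m n p : ℕ} (F : TypedHypergraph S m n) (G : TypedHypergraph S n p),
        P.comp F.toClass G.toClass = (F.comp G).toClass) ∧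
      (∀ {m n p q : ℕ} (F : TypedHypergraph S m n) (G : TypedHypergraph S p q),
        P.tensor F.toClass G.toClass = (F.tensor G).toClass) ∧
      (∀ m n : ℕ, P.swap m n = (TypedHypergraph.compositeSwap S m n).toClass) ∧
      (∀ (x : ℕ) {m n : ℕ} (F : TypedHypergraph S (x + m) (x + n)),
        P.trace x F.toClass = (TypedHypergraph.trace x F).toClass) :=
  ⟨hypTracedPROP S, fun _ => rfl,
    -- The only clause that is not definitional: the vertices of `identity S 0` form `Fin 0`, those
    -- of the empty hypergraph form `Empty`.
    TypedHypergraph.toClass_eq.2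
      (TypedHypergraph.hypIso_iff.2 ⟨TypedHypergraph.WireIso.identityZero⟩),
    fun _ _ => rfl, fun _ _ => rfl, fun _ _ => rfl, fun _ _ _ _ => rfl⟩
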